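/- Let $F$ be a measurable space (the feature space, for instance a compact subset of $\mathbb{R}^d$ with its Borel $\sigma$-algebra), let $\mathcal{D}$ be a probability measure on $F$, and let $c>0$. All featured rooted graphs $(G,v,\chi)$, with $\chi\colon V(G)\to F$, are considered up to isomorphisms that preserve the root and the features. A set of finite featured rooted graphs (closed under isomorphism) is called measurable if for every $m$ and every rooted graph $(G,v)$ on the vertex set $\{0,\dots,m-1\}$ the set of those $\chi\in F^m$ for which $(G,v,\chi)$ belongs to it is measurable in the product space $F^m$. For a graph $G$ with features $\chi$ and $v\in V(G)$, let $\mathcal{N}_r(v)$ be the subgraph of $G$ induced by the vertices at distance at most $r$ from $v$, with root $v$ and the features inherited from $\chi$. For $n\ge c$ let $\mathcal{G}_{\mathcal{D}}(n,c/n)$ be the random featured graph on $[n]$ whose graph is the Erdős–Rényi graph $\mathcal{G}(n,c/n)$ and whose vertex features are i.i.d. with law $\mathcal{D}$, independent of the graph. Let $\mathrm{FBP}|_r$ be the random featured rooted tree formed by the generations $0,\dots,r$ of the branching process in which the numbers of children of the vertices are independent Poisson variables with mean $c$, with features that are i.i.d. with law $\mathcal{D}$, independent of the tree. Theorem. Let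 $r\ge 0$ be an integer and let $\mathcal{T}$ be a measurable set of finite featured rooted trees of height at most $r$. Then for every $\epsilon>0$, \[ \lim_{n\to\infty}\Pr_{\mathcal{G}_{\mathcal{D}}(n,c/n)}\left(\left|\frac{|\{v\in[n] : \mathcal{N}_r(v)\in\mathcal{T}\}|}{n}-\Pr(\mathrm{FBP}|_r\in\mathcal{T})\right|>\epsilon\right)=0 . \] -/

import Mathlib

open MeasureTheory ProbabilityTheory Filter Topology
open scoped NNReal ENNReal

/-- A finite rooted graph on a vertex set `{0, …, size - 1}`. -/
structure FinRootedGraph : Type where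
  size : ℕ
  graph : SimpleGraph (Fin size)
  root : Fin size

/-- A labelled finite featured rooted graph: a finite rooted graph together with a feature in `F`
for every vertex. As a measurable space it is the disjoint union, over the countably many finite
rooted graphs, of the product spaces `F ^ size`. -/
abbrev LabelledFRG (F : Type*) : Type _ := Σ s : FinRootedGraph, (Fin s.size → F)

/-- Isomorphism of featured rooted graphs: a graph isomorphism that preserves root and features. -/
def LabelledFRG.Iso {F : Type*} (x y : LabelledFRG F) : Prop :=
  ∃ e : x.1.graph ≃g y.1.graph, e x.1.root = y.1.root ∧ ∀ v, y.2 (e v) = x.2 v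

instance LabelledFRG.setoid (F : Type*) : Setoid (LabelledFRG F) where
  r := LabelledFRG.Iso
  iseqv :=
    { refl := fun _ => ⟨SimpleGraph.Iso.refl, rfl, fun _ => rfl⟩
      symm := by
        rintro x y ⟨e, h1, h2⟩
        refine ⟨e.symm, ?_, fun v => ?_⟩
        · rw [← h1]
          exact e.symm_apply_apply _
        · refine (h2 (e.symm v)).symm.trans ?_
          exact congrArg y.2 (e.apply_symm_apply v)
      trans := by
        rintro x y z ⟨e, h1, h2⟩ ⟨f, h3, h4⟩
        refine ⟨e.trans f, ?_, fun v => ?_⟩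
        · change f (e x.1.root) = z.1.root
          rw [h1, h3]
        · change z.2 (f (e v)) = x.2 v
          rw [h4, h2] }

/-- Finite featured rooted graphs up to isomorphism, with the quotient σ-algebra: a set `T` of
isomorphism classes is measurable iff for every finite rooted graph `(G, root)` on
`{0, …, m - 1}` the set of feature assignments `χ ∈ F ^ m` for which the class of `(G, root, χ)`
belongs to `T` is a measurable subset of `F ^ m`. -/
abbrev FeaturedRootedGraph (F : Type*) : Type _ := Quotient (LabelledFRG.setoid F)

/-- The isomorphism class of the featured rooted graph `(G, root, χ)` on a finite vertex set `V`. -/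
noncomputable def FeaturedRootedGraph.of {F V : Type*} [Finite V] (G : SimpleGraph V) (root : V)
    (χ : V → F) : FeaturedRootedGraph F :=
  Quotient.mk (LabelledFRG.setoid F)
    ⟨⟨Nat.card V, G.map (Finite.equivFin V).toEmbedding, Finite.equivFin V root⟩,
      fun i => χ ((Finite.equivFin V).symm i)⟩

/-- `T` is (the class of) a featured rooted tree of height at most `r`: the underlying graph is a
tree all of whose vertices are within distance `r` of the root. -/
def FeaturedRootedGraph.IsTreeOfHeightLE {F : Type*} (r : ℕ) (T : FeaturedRootedGraph F) : Prop :=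
  ∃ x : LabelledFRG F, Quotient.mk (LabelledFRG.setoid F) x = T ∧
    x.1.graph.IsTree ∧ ∀ v, x.1.graph.edist x.1.root v ≤ r

theorem self_mem_ball {V : Type*} (G : SimpleGraph V) (r : ℕ) (v : V) :
    v ∈ {w | G.edist v w ≤ r} := by
  simp

/-- The featured `r`-ball around `v` in the finite featured graph `(G, χ)`: the subgraph of `G`
induced by the vertices at distance at most `r` from `v`, rooted at `v`, with the features
inherited from `χ`, up to isomorphism. -/
noncomputable def featuredBall {F V : Type*} [Finite V] (G : SimpleGraph V) (χ : V → F) (r : ℕ)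
    (v : V) : FeaturedRootedGraph F :=
  FeaturedRootedGraph.of (G.induce {w | G.edist v w ≤ r}) ⟨v, self_mem_ball G r v⟩
    (fun w => χ w)

/-- The law of the random featured graph `𝒢_D(n, p)`: an Erdős–Rényi graph `G(n, p)` and,
independently of it, i.i.d. vertex features with law `D`. -/
noncomputable def featuredGnp {F : Type*} [MeasurableSpace F] (D : Measure F) (n : ℕ)
    (p : unitInterval) : Measure (SimpleGraph (Fin n) × (Fin n → F)) :=
  (SimpleGraph.binomialRandom (Fin n) p).prod (Measure.pi fun _ => D)

/-- Potential individuals of the branching process are finite words of natural numbers: `[]` is the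
root and `i :: u` is the `i`-th potential child of `u`; it is born iff `u` is born and `i < N u`,
where `N u` is the number of children of `u`. -/
def IsBorn (N : List ℕ → ℕ) : List ℕ → Prop
  | [] => True
  | i :: u => IsBorn N u ∧ i < N u

/-- The individuals of the generations `0, …, r`. -/
def bornUpTo (N : List ℕ → ℕ) (r : ℕ) : Set (List ℕ) := {u | IsBorn N u ∧ u.length ≤ r}

theorem nil_mem_bornUpTo (N : List ℕ → ℕ) (r : ℕ) : [] ∈ bornUpTo N r :=
  ⟨trivial, Nat.zero_le r⟩

theorem bornUpTo_finite (N : List ℕ → ℕ) (r : ℕ) : (bornUpTo N r).Finite := by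
  induction r with
  | zero =>
    refine (Set.finite_singleton ([] : List ℕ)).subset ?_
    rintro u ⟨-, hu⟩
    simpa using hu
  | succ r ih =>
    refine ((Set.finite_singleton ([] : List ℕ)).union
      (ih.biUnion fun u _ => (Set.finite_Iio (N u)).image fun i => i :: u)).subset ?_
    rintro u ⟨hb, hl⟩
    cases u with
    | nil => exact Or.inl rfl
    | cons i u =>
      refine Or.inr (Set.mem_biUnion (x := u) ⟨hb.1, ?_⟩ ⟨i, hb.2, rfl⟩)
      simpa using hl

instance bornUpTo_finite_coe (N : List ℕ → ℕ) (r : ℕ) : Finite (bornUpTo N r) :=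
  (bornUpTo_finite N r).to_subtype

/-- The parent–child graph on all words: `u` is adjacent to each `i :: u`. -/
def parentChildGraph : SimpleGraph (List ℕ) :=
  SimpleGraph.fromRel fun u w => ∃ i : ℕ, w = i :: u

/-- The first `r` generations of the genealogical tree with offspring numbers `N`, with the features
`χ`, rooted at the initial individual, up to isomorphism. -/
noncomputable def truncatedTree {F : Type*} (r : ℕ) (N : List ℕ → ℕ) (χ : List ℕ → F) :
    FeaturedRootedGraph F :=
  FeaturedRootedGraph.of (parentChildGraph.induce (bornUpTo N r)) ⟨[], nil_mem_bornUpTo N r⟩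
    (fun u => χ u)

/-- The probability space of the featured branching process: i.i.d. offspring numbers with the
Poisson law of mean `c` and, independently of them, i.i.d. features with law `D`. -/
noncomputable def fbpMeasure {F : Type*} [MeasurableSpace F] (c : ℝ≥0) (D : Measure F)
    [IsProbabilityMeasure D] : Measure ((List ℕ → ℕ) × (List ℕ → F)) :=
  (Measure.infinitePi fun _ : List ℕ => poissonMeasure c).prod
    (Measure.infinitePi fun _ : List ℕ => D)

/-- `FBP|_r(𝒯)`: the probability that the first `r` generations of the featured branching process,
as a featured rooted tree, belong to `𝒯`. -/
noncomputable def fbpTruncProb {F : Type*} [MeasurableSpace F] (c : ℝ≥0) (D : Measure F)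
    [IsProbabilityMeasure D] (r : ℕ) (𝒯 : Set (FeaturedRootedGraph F)) : ℝ :=
  (fbpMeasure c D).real {ω | truncatedTree r ω.1 ω.2 ∈ 𝒯}

/-- The proportion of the vertices `v` of the featured graph `(G, χ)` on `n` vertices whose featured
`r`-ball belongs to `𝒯`. -/
noncomputable def ballProportion {F : Type*} {n : ℕ} (G : SimpleGraph (Fin n)) (χ : Fin n → F)
    (r : ℕ) (𝒯 : Set (FeaturedRootedGraph F)) : ℝ :=
  (Set.ncard {v : Fin n | featuredBall G χ r v ∈ 𝒯} : ℝ) / n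

/-! The proportion of vertices with ball in `𝒯` is bounded in probability from below only. The same
lower bound for the complement of `𝒯` is the upper bound for `𝒯`, by `ballProportion_compl` and
`one_le_fbpTruncProb_add_compl`.

For the lower bound, tree shapes are treated one at a time. A shape is the ordered tree cut out by
offspring numbers `N`; an occurrence in the graph is a local copy whose siblings carry increasing
labels. This ordering makes the copy with a given root unique (`IsLocalCopy.unique`), so copies
count vertices without repetition. There are about `n * ∏ u, n.choose (N u)` candidate maps, and
each is a copy with probability about `(c / n) ^ (∑ u, N u) * ∏ u, exp (-c)`, times the probability
of the features. Dividing by `n` gives in the limit the product of the Poisson weights `exp (-c) * c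
^ N u / (N u)!`, the branching process probability of the shape.

Concentration is a second moment argument. Pairs of copies with disjoint images contribute
asymptotically at most the square of the mean; overlapping pairs have roots at distance at most `2 *
r`, and the expected number of such pairs of vertices is `O(n)`. Finally, finitely many shapes carry
all but a small part of the mass of the branching process (`exists_finite_shapes`). -/

/-! ### Edge patterns in the binomial random graph. -/

theorem measurableSet_simpleGraph {V : Type*} [Finite V] (s : Set (SimpleGraph V)) :
    MeasurableSet s := by
  rw [← Set.preimage_image_eq s SimpleGraph.edgeSet_injective]
  exact SimpleGraph.measurable_edgeSet (Set.toFinite _).measurableSet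

/-- Under the binomial random graph, the probability that all edges in `P` are present and all edges
in `Q` are absent. -/
theorem binomialRandom_real_prescribed {V : Type*} [Fintype V] (p : unitInterval)
    (P Q : Finset (Sym2 V)) (hPQ : Disjoint P Q) (hP : ∀ e ∈ P, ¬ e.IsDiag)
    (hQ : ∀ e ∈ Q, ¬ e.IsDiag) :
    (SimpleGraph.binomialRandom V p).real
      {G | (∀ e ∈ P, e ∈ G.edgeSet) ∧ ∀ e ∈ Q, e ∉ G.edgeSet} =
      (p : ℝ) ^ P.card * (1 - p : ℝ) ^ Q.card := by
  classical
  rw [SimpleGraph.binomialRandom_eq_map, measureReal_def,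
    Measure.map_apply (by fun_prop) (measurableSet_simpleGraph _), setBernoulli_apply']
  have : ((fun f : Sym2 V → Prop => {i | f i}) ⁻¹' (SimpleGraph.fromEdgeSet ⁻¹'
      {G : SimpleGraph V | (∀ e ∈ P, e ∈ G.edgeSet) ∧ ∀ e ∈ Q, e ∉ G.edgeSet})) =
      (((P ∪ Q : Finset (Sym2 V)) : Set (Sym2 V)).pi fun e => if e ∈ P then {True} else {False}) := by
    ext f
    simp only [Set.mem_preimage, Set.mem_ofPred_eq, SimpleGraph.edgeSet_fromEdgeSet, Set.mem_sdiff,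
      Set.mem_pi, Finset.coe_union, Set.mem_union, Finset.mem_coe]
    constructor
    · rintro ⟨h1, h2⟩ e he
      by_cases heP : e ∈ P
      · simpa [heP] using (h1 e heP).1
      · have heQ := he.resolve_left heP
        have := h2 e heQ
        simp only [heP, if_false, Set.mem_singleton_iff, eq_iff_iff, iff_false]
        intro hf
        exact this ⟨hf, hQ e heQ⟩
    · intro h
      refine ⟨fun e he => ⟨?_, hP e he⟩, fun e he hc => ?_⟩
      · simpa [he] using h e (Or.inl he)
      · have heP : e ∉ P := fun h' => Finset.disjoint_left.1 hPQ h' he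
        have := h e (Or.inr he)
        simp only [heP, if_false, Set.mem_singleton_iff, eq_iff_iff, iff_false] at this
        exact this hc.1
  rw [this, Measure.infinitePi_pi _ (fun _ _ => .of_discrete), Finset.prod_union hPQ,
    ENNReal.toReal_mul, ENNReal.toReal_prod, ENNReal.toReal_prod]
  congr 1
  · refine Finset.prod_eq_pow_card fun e he => ?_
    have := hP e he
    simp [he, Sym2.diagSet, this]
  · refine Finset.prod_eq_pow_card fun e he => ?_
    have := hQ e he
    have heP : e ∉ P := fun h' => Finset.disjoint_left.1 hPQ h' he
    simp [heP, Sym2.diagSet, this]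

/-- Pairs inside the image of `ψ` other than the pattern edges are left free, which keeps the count
of prescribed pairs exact. This form serves the upper bounds. -/
theorem binomialRandom_real_pattern {V W I J : Type*} [Fintype V] [Fintype W] [Fintype I]
    [Fintype J] (p : unitInterval) {ψ : W → V} (hψ : ψ.Injective) {e : J → W × W}
    (he : (fun j => s((e j).1, (e j).2)).Injective) (hne : ∀ j, (e j).1 ≠ (e j).2)
    {ι : I → W} (hι : ι.Injective) :
    (SimpleGraph.binomialRandom V p).real
      {G | (∀ j, G.Adj (ψ (e j).1) (ψ (e j).2)) ∧
        ∀ i, ∀ w ∉ Set.range ψ, ¬ G.Adj (ψ (ι i)) w} =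
      (p : ℝ) ^ Fintype.card J *
        (1 - p : ℝ) ^ (Fintype.card I * (Fintype.card V - Fintype.card W)) := by
  classical
  let f : J → Sym2 V := fun j => s(ψ (e j).1, ψ (e j).2)
  let g : I × {w // w ∉ Set.range ψ} → Sym2 V := fun x => s(ψ (ι x.1), x.2.1)
  have hf : f.Injective := fun a b hab => he (Sym2.map.injective hψ (by simpa [f] using hab))
  have hg : g.Injective := by
    rintro ⟨i, w, hw⟩ ⟨i', w', hw'⟩ h
    simp only [g, Sym2.eq_iff] at h
    rcases h with ⟨h1, h2⟩ | ⟨h1, -⟩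
    · rw [Prod.mk.injEq, Subtype.mk.injEq]
      exact ⟨hι (hψ h1), h2⟩
    · exact absurd ⟨_, h1⟩ hw'
  have key := binomialRandom_real_prescribed p (Finset.univ.image f) (Finset.univ.image g)
    (by
      rw [Finset.disjoint_left]
      simp only [Finset.mem_image, Finset.mem_univ, true_and, not_exists, forall_exists_index,
        f, g]
      rintro _ j rfl ⟨i, w, hw⟩ h
      rw [Sym2.eq_iff] at h
      rcases h with ⟨-, h1⟩ | ⟨-, h1⟩
      · exact hw ⟨_, h1.symm⟩
      · exact hw ⟨_, h1.symm⟩)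
    (by
      simp only [Finset.mem_image, Finset.mem_univ, true_and, forall_exists_index,
        forall_apply_eq_imp_iff, f, Sym2.mk_isDiag_iff]
      exact fun j h => hne j (hψ h))
    (by
      simp only [Finset.mem_image, Finset.mem_univ, true_and, forall_exists_index,
        forall_apply_eq_imp_iff, g, Sym2.mk_isDiag_iff]
      exact fun x h => x.2.2 ⟨_, h⟩)
  rw [Finset.card_image_of_injective _ hf, Finset.card_image_of_injective _ hg] at key
  have hc : Fintype.card {w // w ∉ Set.range ψ} = Fintype.card V - Fintype.card W := by
    rw [Fintype.card_subtype_compl]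
    congr 1
    exact Set.card_range_of_injective hψ
  rw [Finset.card_univ, Finset.card_univ, Fintype.card_prod, hc] at key
  rw [← key]
  congr 1
  ext G
  refine and_congr ?_ ⟨fun h x hx => ?_, fun h i w hw => ?_⟩
  · simp [f]
  · obtain ⟨⟨i, w, hw⟩, -, rfl⟩ := Finset.mem_image.1 hx
    exact h i w hw
  · exact h _ (Finset.mem_image.2 ⟨(i, ⟨w, hw⟩), Finset.mem_univ _, rfl⟩)

/-- Counterpart for lower bounds, where the induced graph on the image is fully prescribed. The
exponent of `1 - p` overcounts the forbidden pairs by bounding them by `I × V` and `W × W`; for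
fixed pattern and `p = c / n` this excess is asymptotically harmless. -/
theorem le_binomialRandom_real_pattern {V W I J : Type*} [Fintype V] [Fintype W] [Fintype I]
    [Fintype J] (p : unitInterval) {ψ : W → V} (hψ : ψ.Injective) {e : J → W × W}
    (he : (fun j => s((e j).1, (e j).2)).Injective) (hne : ∀ j, (e j).1 ≠ (e j).2)
    (ι : I → W) :
    (p : ℝ) ^ Fintype.card J *
        (1 - p : ℝ) ^ (Fintype.card I * Fintype.card V + Fintype.card W ^ 2) ≤
    (SimpleGraph.binomialRandom V p).real
      {G | (∀ a b, G.Adj (ψ a) (ψ b) ↔ ∃ j, s((e j).1, (e j).2) = s(a, b)) ∧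
        ∀ i w, G.Adj (ψ (ι i)) w → w ∈ Set.range ψ} := by
  classical
  let f : J → Sym2 V := fun j => s(ψ (e j).1, ψ (e j).2)
  have hf : f.Injective := fun a b hab => he (Sym2.map.injective hψ (by simpa [f] using hab))
  let P := Finset.univ.image f
  let Q₁ := Finset.univ.image fun x : I × V => s(ψ (ι x.1), x.2)
  let Q₂ := Finset.univ.image fun x : W × W => s(ψ x.1, ψ x.2)
  let Q := ((Q₁ ∪ Q₂) \ P).filter fun e => ¬ e.IsDiag
  have hQc : Q.card ≤ Fintype.card I * Fintype.card V + Fintype.card W ^ 2 := by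
    refine (Finset.card_filter_le _ _).trans ((Finset.card_le_card Finset.sdiff_subset).trans
      ((Finset.card_union_le _ _).trans (add_le_add ?_ ?_)))
    · refine Finset.card_image_le.trans ?_
      simp
    · refine Finset.card_image_le.trans ?_
      simp [sq]
  have key := binomialRandom_real_prescribed p P Q
    (Finset.disjoint_left.2 fun x hx hx' =>
      (Finset.mem_sdiff.1 (Finset.mem_filter.1 hx').1).2 hx)
    (by
      simp only [P, Finset.mem_image, Finset.mem_univ, true_and, forall_exists_index,
        forall_apply_eq_imp_iff, f, Sym2.mk_isDiag_iff]
      exact fun j h => hne j (hψ h))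
    (fun x hx => (Finset.mem_filter.1 hx).2)
  rw [Finset.card_image_of_injective _ hf, Finset.card_univ] at key
  refine le_trans (le_trans ?_ key.ge) (measureReal_mono ?_ (measure_ne_top _ _))
  · refine mul_le_mul_of_nonneg_left ?_ (pow_nonneg p.2.1 _)
    exact pow_le_pow_of_le_one (sub_nonneg.2 p.2.2) (sub_le_self _ p.2.1) hQc
  · rintro G ⟨hP, hQ⟩
    refine ⟨fun a b => ⟨fun h => ?_, ?_⟩, fun i w h => ?_⟩
    · have h1 : s(ψ a, ψ b) ∈ P := by
        by_contra hn
        refine hQ s(ψ a, ψ b) ?_ h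
        refine Finset.mem_filter.2 ⟨Finset.mem_sdiff.2 ⟨Finset.mem_union_right _ ?_, hn⟩, ?_⟩
        · exact Finset.mem_image.2 ⟨(a, b), Finset.mem_univ _, rfl⟩
        · simpa using h.ne
      obtain ⟨j, -, hj⟩ := Finset.mem_image.1 h1
      exact ⟨j, Sym2.map.injective hψ (by simpa [f] using hj)⟩
    · rintro ⟨j, hj⟩
      have h1 : s(ψ a, ψ b) ∈ P := by
        refine Finset.mem_image.2 ⟨j, Finset.mem_univ _, ?_⟩
        exact congrArg (Sym2.map ψ) hj
      exact hP _ h1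
    · have h1 : s(ψ (ι i), w) ∈ P := by
        by_contra hn
        refine hQ s(ψ (ι i), w) ?_ h
        refine Finset.mem_filter.2 ⟨Finset.mem_sdiff.2 ⟨Finset.mem_union_left _ ?_, hn⟩, ?_⟩
        · exact Finset.mem_image.2 ⟨(i, w), Finset.mem_univ _, rfl⟩
        · simpa using h.ne
      obtain ⟨j, -, hj⟩ := Finset.mem_image.1 h1
      rcases Sym2.eq_iff.1 hj with ⟨-, h2⟩ | ⟨h2, -⟩
      · exact ⟨_, h2⟩
      · exact ⟨_, h2⟩

/-! ### Second moment inequality. -/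

/-- One-sided Chebyshev bound for the number of events that occur. -/
theorem measureReal_count_lt_le {Ω I : Type*} [MeasurableSpace Ω] [Fintype I] (μ : Measure Ω)
    [IsProbabilityMeasure μ] {E : I → Set Ω} (hE : ∀ i, MeasurableSet (E i)) {q δ s a b : ℝ}
    (hq : 0 ≤ q) (hδ : 0 < δ) (ha : a ≤ (∑ i, μ.real (E i)) * s)
    (hb : (∑ i, ∑ j, μ.real (E i ∩ E j)) * s ^ 2 ≤ b) :
    μ.real {ω | (Set.ncard {i | ω ∈ E i} : ℝ) * s < q - δ} ≤ (b - 2 * q * a + q ^ 2) / δ ^ 2 := by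
  classical
  let X : Ω → ℝ := fun ω => (∑ i, (E i).indicator 1 ω) * s
  have hX : ∀ ω, (Set.ncard {i | ω ∈ E i} : ℝ) * s = X ω := by
    intro ω
    simp only [X, Set.indicator_apply, Pi.one_apply, Finset.sum_boole]
    congr 2
    rw [Set.ncard_eq_toFinset_card']
    congr 1
    ext i
    simp
  have hint : ∀ i, Integrable ((E i).indicator (1 : Ω → ℝ)) μ := fun i =>
    (integrable_const (1 : ℝ)).indicator (hE i)
  have hXint : Integrable X μ := (integrable_finsetSum _ fun i _ => hint i).mul_const s
  have hEX : ∫ ω, X ω ∂μ = (∑ i, μ.real (E i)) * s := by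
    simp only [X]
    rw [integral_mul_const, integral_finsetSum _ fun i _ => hint i]
    simp [integral_indicator_one, hE]
  have hX2 : ∀ ω, X ω ^ 2 = (∑ i, ∑ j, (E i ∩ E j).indicator 1 ω) * s ^ 2 := by
    intro ω
    simp only [X, mul_pow]
    rw [sq (∑ i, _), Finset.sum_mul_sum]
    simp [Set.inter_indicator_one]
  have hint2 : ∀ i j, Integrable ((E i ∩ E j).indicator (1 : Ω → ℝ)) μ := fun i j =>
    (integrable_const (1 : ℝ)).indicator ((hE i).inter (hE j))
  have hX2int : Integrable (fun ω => X ω ^ 2) μ := by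
    simp only [hX2]
    exact (integrable_finsetSum _ fun i _ => integrable_finsetSum _ fun j _ =>
      hint2 i j).mul_const _
  have hEX2 : ∫ ω, X ω ^ 2 ∂μ = (∑ i, ∑ j, μ.real (E i ∩ E j)) * s ^ 2 := by
    simp only [hX2]
    rw [integral_mul_const, integral_finsetSum _ fun i _ => integrable_finsetSum _ fun j _ =>
      hint2 i j]
    congr 1
    refine Finset.sum_congr rfl fun i _ => ?_
    rw [integral_finsetSum _ fun j _ => hint2 i j]
    exact Finset.sum_congr rfl fun j _ => integral_indicator_one ((hE i).inter (hE j))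
  have hYint : Integrable (fun ω => (X ω - q) ^ 2) μ := by
    have : (fun ω => (X ω - q) ^ 2) = fun ω => X ω ^ 2 - 2 * q * X ω + q ^ 2 := by
      ext ω; ring
    rw [this]
    exact (hX2int.sub (hXint.const_mul _)).add (integrable_const _)
  -- Expanding around `q` instead of the mean requires only a lower bound on the first moment,
  -- because `0 ≤ q`, and an upper bound on the second.
  have hEY : ∫ ω, (X ω - q) ^ 2 ∂μ ≤ b - 2 * q * a + q ^ 2 := by
    have : (fun ω => (X ω - q) ^ 2) = fun ω => (X ω ^ 2 - 2 * q * X ω) + q ^ 2 := by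
      ext ω; ring
    rw [this, integral_add (f := fun ω => X ω ^ 2 - 2 * q * X ω) (hX2int.sub (hXint.const_mul _)) (integrable_const _),
      integral_sub hX2int (hXint.const_mul _), integral_const_mul, hEX, hEX2]
    simp only [integral_const, probReal_univ, one_smul]
    nlinarith
  have hmarkov := mul_meas_ge_le_integral_of_nonneg (μ := μ)
    (Eventually.of_forall fun ω => sq_nonneg (X ω - q)) hYint (δ ^ 2)
  rw [le_div_iff₀ (by positivity), mul_comm]
  refine le_trans (mul_le_mul_of_nonneg_left (measureReal_mono ?_ (measure_ne_top _ _))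
    (sq_nonneg δ)) (hmarkov.trans hEY)
  intro ω hω
  have hω' : X ω < q - δ := by simpa only [hX, Set.mem_ofPred_eq] using hω
  change δ ^ 2 ≤ (X ω - q) ^ 2
  nlinarith

/-! ### Marginals of i.i.d. features. -/

theorem measurePreserving_pi_comp {F V W : Type*} [MeasurableSpace F] [Fintype V] [Fintype W]
    (D : Measure F) [IsProbabilityMeasure D] {φ : W → V} (hφ : φ.Injective) :
    MeasurePreserving (fun χ : V → F => χ ∘ φ) (Measure.pi fun _ => D) (Measure.pi fun _ => D) := by
  refine ⟨by fun_prop, ?_⟩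
  have h : iIndepFun (fun i (χ : V → F) => χ i) (Measure.pi fun _ : V => D) :=
    iIndepFun_pi (X := fun _ => id) fun _ => aemeasurable_id
  have h2 := (h.precomp hφ).map_fun_eq_pi_map fun i => (measurable_pi_apply _).aemeasurable
  refine h2.trans ?_
  congr 1
  ext1 i
  exact (measurePreserving_eval (fun _ : V => D) (φ i)).map_eq

theorem pi_real_comp_mem {F V W : Type*} [MeasurableSpace F] [Fintype V] [Fintype W]
    (D : Measure F) [IsProbabilityMeasure D] {φ : W → V} (hφ : φ.Injective)
    {A : Set (W → F)} (hA : MeasurableSet A) :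
    (Measure.pi fun _ : V => D).real {χ | χ ∘ φ ∈ A} = (Measure.pi fun _ : W => D).real A :=
  (measurePreserving_pi_comp D hφ).measureReal_preimage hA.nullMeasurableSet

/-- Injectivity of `Sum.elim φ φ'` makes the two images disjoint, so the two feature vectors are
independent. -/
theorem pi_real_comp_mem_and_comp_mem {F V W : Type*} [MeasurableSpace F] [Fintype V] [Fintype W]
    (D : Measure F) [IsProbabilityMeasure D] {φ φ' : W → V}
    (h : (Sum.elim φ φ').Injective) {A : Set (W → F)} (hA : MeasurableSet A) :
    (Measure.pi fun _ : V => D).real {χ | χ ∘ φ ∈ A ∧ χ ∘ φ' ∈ A} =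
      (Measure.pi fun _ : W => D).real A ^ 2 := by
  have hS := (measurePreserving_sumPiEquivProdPi fun _ : W ⊕ W => D).comp
    (measurePreserving_pi_comp D h)
  have := hS.measureReal_preimage (s := A ×ˢ A) (hA.prod hA).nullMeasurableSet
  rw [measureReal_prod_prod, ← sq] at this
  exact this

theorem infinitePi_real_restrict_mem {F ι : Type*} [MeasurableSpace F] (D : Measure F)
    [IsProbabilityMeasure D] (s : Set ι) [Fintype s] {A : Set (s → F)} (hA : MeasurableSet A) :
    (Measure.infinitePi fun _ : ι => D).real {χ | (fun u : s => χ u) ∈ A} =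
      (Measure.pi fun _ : s => D).real A := by
  have h := Measure.infinitePi_map_restrict' (μ := fun _ : ι => D) (I := s)
  rw [Measure.infinitePi_eq_pi (ι := s)] at h
  rw [← h, measureReal_def, measureReal_def, Measure.map_apply (by fun_prop) hA]
  rfl

/-! ### Expected number of pairs of vertices at bounded distance. -/

theorem SimpleGraph.exists_embedding_of_edist_le {V : Type*} {G : SimpleGraph V} {R : ℕ} {v w : V}
    (h : G.edist v w ≤ R) :
    ∃ l ≤ R, ∃ x : Fin (l + 1) ↪ V, x 0 = v ∧ x (Fin.last l) = w ∧
      ∀ j : Fin l, G.Adj (x j.castSucc) (x j.succ) := by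
  have hr : G.Reachable v w := by
    rw [← SimpleGraph.edist_ne_top_iff_reachable]
    exact ne_top_of_le_ne_top (ENat.natCast_ne_top R) h
  obtain ⟨p, hp, hl⟩ := hr.exists_path_of_dist
  have hd : p.length ≤ R := by
    rw [hl]
    have h2 := hr.coe_dist_eq_edist
    rw [← h2] at h
    exact_mod_cast h
  refine ⟨p.length, hd, ⟨fun i => p.getVert i, fun i j hij => ?_⟩, ?_, ?_, fun j => ?_⟩
  · exact Fin.ext (hp.getVert_injOn (by simpa using Nat.lt_succ_iff.1 i.2)
      (by simpa using Nat.lt_succ_iff.1 j.2) hij)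
  · exact p.getVert_zero
  · exact p.getVert_length
  · exact p.adj_getVert_succ j.2

/-- Union bound over self-avoiding paths: at most `|V| ^ (l + 1)` of them have length `l`, and each
is present with probability `p ^ l`. For `p = c / n` the total is `O(n)`. -/
theorem sum_binomialRandom_real_edist_le {V : Type*} [Fintype V] (p : unitInterval) (R : ℕ) :
    ∑ v : V, ∑ w : V, (SimpleGraph.binomialRandom V p).real {G | G.edist v w ≤ R} ≤
      Fintype.card V * ∑ l ∈ Finset.range (R + 1), (Fintype.card V * p : ℝ) ^ l := by
  classical
  have h1 : ∀ v w : V, (SimpleGraph.binomialRandom V p).real {G | G.edist v w ≤ R} ≤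
      ∑ l ∈ Finset.range (R + 1), ∑ x : Fin (l + 1) ↪ V,
        if v = x 0 then if w = x (Fin.last l) then (p : ℝ) ^ l else 0 else 0 := by
    intro v w
    have hsub : {G : SimpleGraph V | G.edist v w ≤ R} ⊆ ⋃ l ∈ Finset.range (R + 1),
        ⋃ x ∈ Finset.univ.filter fun x : Fin (l + 1) ↪ V => v = x 0 ∧ w = x (Fin.last l),
          {G | ∀ j : Fin l, G.Adj (x j.castSucc) (x j.succ)} := by
      intro G hG
      obtain ⟨l, hl, x, h0, h1, h2⟩ := SimpleGraph.exists_embedding_of_edist_le hG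
      simp only [Set.mem_iUnion]
      exact ⟨l, Finset.mem_range.2 (by omega), x, by simp [h0, h1], h2⟩
    refine (measureReal_mono hsub (measure_ne_top _ _)).trans
      ((measureReal_biUnion_finset_le _ _).trans (Finset.sum_le_sum fun l _ => ?_))
    refine (measureReal_biUnion_finset_le _ _).trans ?_
    rw [Finset.sum_filter]
    refine Finset.sum_le_sum fun x _ => ?_
    by_cases hv : v = x 0 <;> by_cases hw : w = x (Fin.last l) <;> 
      simp only [hv, hw, and_true, and_false, if_true, if_false, le_refl, and_self]
    have := binomialRandom_real_pattern p (V := V) (W := Fin (l + 1)) (I := Empty) (J := Fin l)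
      (ψ := x) x.injective (e := fun j => (j.castSucc, j.succ)) (by
        intro i j hij
        simp only [Sym2.eq_iff, Fin.ext_iff, Fin.val_castSucc, Fin.val_succ] at hij ⊢
        omega) (fun j => by simp [Fin.ext_iff]) (ι := Empty.elim) (fun i => i.elim)
    simp only [Fintype.card_fin, Fintype.card_empty, zero_mul, pow_zero, mul_one] at this
    rw [← this]
    refine measureReal_mono (fun G hG => ⟨hG, fun i => i.elim⟩) (measure_ne_top _ _)
  calc _ ≤ ∑ v : V, ∑ w : V, ∑ l ∈ Finset.range (R + 1), ∑ x : Fin (l + 1) ↪ V,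
        (if v = x 0 then if w = x (Fin.last l) then (p : ℝ) ^ l else 0 else 0) :=
        Finset.sum_le_sum fun v _ => Finset.sum_le_sum fun w _ => h1 v w
    _ = ∑ l ∈ Finset.range (R + 1), ∑ x : Fin (l + 1) ↪ V, (p : ℝ) ^ l := by
        rw [Finset.sum_congr rfl fun v _ => Finset.sum_comm, Finset.sum_comm]
        refine Finset.sum_congr rfl fun l _ => ?_
        rw [Finset.sum_congr rfl fun v _ => Finset.sum_comm, Finset.sum_comm]
        refine Finset.sum_congr rfl fun x _ => ?_
        rw [Finset.sum_comm]
        simp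
    _ ≤ _ := by
        rw [Finset.mul_sum]
        refine Finset.sum_le_sum fun l _ => ?_
        rw [Finset.sum_const, nsmul_eq_mul, Finset.card_univ, Fintype.card_embedding_eq,
          Fintype.card_fin, mul_pow, ← mul_assoc, ← pow_succ']
        refine mul_le_mul_of_nonneg_right ?_ (pow_nonneg p.2.1 _)
        exact_mod_cast Nat.descFactorial_le_pow _ _

/-! ### Isomorphism classes: invariance and measurability. -/

theorem FeaturedRootedGraph.of_eq_of_iso {F V W : Type*} [Finite V] [Finite W] {G : SimpleGraph V}
    {H : SimpleGraph W} {v : V} {w : W} {χ : V → F} {ξ : W → F} (e : G ≃g H) (hv : e v = w)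
    (hχ : ∀ x, ξ (e x) = χ x) :
    FeaturedRootedGraph.of G v χ = FeaturedRootedGraph.of H w ξ := by
  refine Quotient.sound ⟨(SimpleGraph.Iso.map (Finite.equivFin V) G).symm.trans
    (e.trans (SimpleGraph.Iso.map (Finite.equivFin W) H)), ?_, fun i => ?_⟩
  · change Finite.equivFin W (e ((Finite.equivFin V).symm (Finite.equivFin V v))) = _
    rw [Equiv.symm_apply_apply, hv]
  · change ξ ((Finite.equivFin W).symm (Finite.equivFin W (e ((Finite.equivFin V).symm i)))) = _
    rw [Equiv.symm_apply_apply, hχ]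

theorem FeaturedRootedGraph.measurable_of {F V : Type*} [MeasurableSpace F] [Finite V]
    (G : SimpleGraph V) (v : V) :
    Measurable fun χ : V → F => FeaturedRootedGraph.of G v χ := by
  refine measurable_quotient_mk''.comp ?_
  let s : FinRootedGraph := ⟨Nat.card V, G.map (Finite.equivFin V).toEmbedding, Finite.equivFin V v⟩
  have h1 : Measurable fun x : Fin s.size → F => (⟨s, x⟩ : LabelledFRG F) :=
    fun t ht => MeasurableSpace.measurableSet_iInf.1 ht s
  exact h1.comp (g := fun x : Fin s.size → F => (⟨s, x⟩ : LabelledFRG F))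
    (f := fun (χ : V → F) (i : Fin s.size) => χ ((Finite.equivFin V).symm i)) (by fun_prop)

/-! ### Combinatorics of the truncated genealogical tree. -/

theorem parentChildGraph_adj {u w : List ℕ} :
    parentChildGraph.Adj u w ↔ (∃ i, w = i :: u) ∨ ∃ i, u = i :: w := by
  rw [parentChildGraph, SimpleGraph.fromRel_adj]
  refine ⟨fun h => h.2, fun h => ⟨?_, h⟩⟩
  rintro rfl
  rcases h with ⟨i, h⟩ | ⟨i, h⟩ <;> simpa using congrArg List.length h

/-- The individuals of the generations `0, …, r - 1`. -/
def bornBefore (N : List ℕ → ℕ) (r : ℕ) : Set (List ℕ) := {u | IsBorn N u ∧ u.length < r}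

theorem bornBefore_subset (N : List ℕ → ℕ) (r : ℕ) : bornBefore N r ⊆ bornUpTo N r :=
  fun _ h => ⟨h.1, h.2.le⟩

noncomputable instance (N : List ℕ → ℕ) (r : ℕ) : Fintype (bornUpTo N r) := Fintype.ofFinite _

noncomputable instance (N : List ℕ → ℕ) (r : ℕ) : Fintype (bornBefore N r) :=
  ((bornUpTo_finite N r).subset (bornBefore_subset N r)).fintype

theorem cons_mem_bornUpTo {N : List ℕ → ℕ} {r i : ℕ} {u : List ℕ} :
    i :: u ∈ bornUpTo N r ↔ u ∈ bornBefore N r ∧ i < N u := by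
  simp only [bornUpTo, bornBefore, Set.mem_ofPred_eq, IsBorn, List.length_cons]
  grind

theorem tail_mem_bornUpTo {N : List ℕ → ℕ} {r : ℕ} {u : List ℕ} (h : u ∈ bornUpTo N r) :
    u.tail ∈ bornUpTo N r := by
  cases u with
  | nil => exact h
  | cons i u => exact bornBefore_subset N r (cons_mem_bornUpTo.1 h).1

/-- The edges of the tree of the generations `0, …, r`, as pairs of a parent and the index of one
of its children. -/
abbrev TreeEdge (N : List ℕ → ℕ) (r : ℕ) : Type := Σ u : bornBefore N r, Fin (N u)

/-- The parent in an edge. -/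
def TreeEdge.parent {N : List ℕ → ℕ} {r : ℕ} (e : TreeEdge N r) : bornUpTo N r :=
  ⟨e.1, bornBefore_subset N r e.1.2⟩

/-- The child in an edge. -/
def TreeEdge.child {N : List ℕ → ℕ} {r : ℕ} (e : TreeEdge N r) : bornUpTo N r :=
  ⟨e.2 :: e.1, cons_mem_bornUpTo.2 ⟨e.1.2, e.2.2⟩⟩

theorem TreeEdge.child_injective {N : List ℕ → ℕ} {r : ℕ} :
    (TreeEdge.child : TreeEdge N r → bornUpTo N r).Injective := by
  rintro ⟨⟨u, hu⟩, i, hi⟩ ⟨⟨w, hw⟩, j, hj⟩ h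
  simp only [TreeEdge.child, Subtype.mk.injEq, List.cons.injEq] at h
  obtain ⟨rfl, rfl⟩ := h
  rfl

theorem eq_nil_or_exists_child {N : List ℕ → ℕ} {r : ℕ} (a : bornUpTo N r) :
    a = ⟨[], nil_mem_bornUpTo N r⟩ ∨ ∃ e : TreeEdge N r, a = e.child := by
  obtain ⟨u, hu⟩ := a
  cases u with
  | nil => exact Or.inl rfl
  | cons i u =>
    exact Or.inr ⟨⟨⟨u, (cons_mem_bornUpTo.1 hu).1⟩, ⟨i, (cons_mem_bornUpTo.1 hu).2⟩⟩, rfl⟩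

/-- Every individual except the root is the child in exactly one edge. This identity later balances
the powers of `n` against those of `p`. -/
theorem card_bornUpTo (N : List ℕ → ℕ) (r : ℕ) :
    Fintype.card (bornUpTo N r) = Fintype.card (TreeEdge N r) + 1 := by
  rw [← Fintype.card_option]
  symm
  refine Fintype.card_of_bijective
    (f := fun o : Option (TreeEdge N r) => o.elim ⟨[], nil_mem_bornUpTo N r⟩ TreeEdge.child)
    ⟨?_, fun a => ?_⟩
  · rintro (_ | e) (_ | e') h
    · rfl
    · simp [TreeEdge.child] at h
    · simp [TreeEdge.child] at h
    · exact congrArg some (TreeEdge.child_injective h)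
  · rcases eq_nil_or_exists_child a with rfl | ⟨e, rfl⟩
    · exact ⟨none, rfl⟩
    · exact ⟨some e, rfl⟩

theorem parentChildGraph_adj_iff_exists_edge {N : List ℕ → ℕ} {r : ℕ} (a b : bornUpTo N r) :
    parentChildGraph.Adj a b ↔ ∃ e : TreeEdge N r, s(e.parent, e.child) = s(a, b) := by
  rw [parentChildGraph_adj]
  constructor
  · rintro (⟨i, h⟩ | ⟨i, h⟩)
    · have := cons_mem_bornUpTo.1 (h ▸ b.2)
      exact ⟨⟨⟨a, this.1⟩, ⟨i, this.2⟩⟩, Sym2.eq_iff.2 (Or.inl ⟨rfl, Subtype.ext h.symm⟩)⟩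
    · have := cons_mem_bornUpTo.1 (h ▸ a.2)
      exact ⟨⟨⟨b, this.1⟩, ⟨i, this.2⟩⟩, Sym2.eq_iff.2 (Or.inr ⟨rfl, Subtype.ext h.symm⟩)⟩
  · rintro ⟨e, he⟩
    rcases Sym2.eq_iff.1 he with ⟨rfl, rfl⟩ | ⟨rfl, rfl⟩
    · exact Or.inl ⟨e.2, rfl⟩
    · exact Or.inr ⟨e.2, rfl⟩

theorem TreeEdge.parent_ne_child {N : List ℕ → ℕ} {r : ℕ} (e : TreeEdge N r) :
    e.parent ≠ e.child := by
  intro h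
  simpa [TreeEdge.parent, TreeEdge.child] using congrArg (fun a => a.1.length) h

theorem TreeEdge.sym2_injective {N : List ℕ → ℕ} {r : ℕ} :
    (fun e : TreeEdge N r => s(e.parent, e.child)).Injective := by
  intro e e' h
  rcases Sym2.eq_iff.1 h with ⟨-, h⟩ | ⟨h1, h2⟩
  · exact TreeEdge.child_injective h
  · have l1 := congrArg (fun a => a.1.length) h1
    have l2 := congrArg (fun a => a.1.length) h2
    simp only [TreeEdge.parent, TreeEdge.child, List.length_cons] at l1 l2
    omega

/-! ### Local copies of a tree and their uniqueness. -/

/-- `φ` embeds the tree of the generations `0, …, r` into `G` as an induced subgraph, all neighbours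
of the vertices of the generations before `r` being in the image. -/
structure IsLocalCopy (N : List ℕ → ℕ) (r : ℕ) {V : Type*} (G : SimpleGraph V)
    (φ : bornUpTo N r → V) : Prop where
  adj_iff : ∀ a b, G.Adj (φ a) (φ b) ↔ parentChildGraph.Adj a.1 b.1
  mem_range : ∀ a : bornUpTo N r, a.1.length < r → ∀ w, G.Adj (φ a) w → w ∈ Set.range φ

/-- `φ` is injective and increasing on the children of each individual. -/
structure IsSiblingIncreasing (N : List ℕ → ℕ) (r : ℕ) {V : Type*} [LT V]
    (φ : bornUpTo N r → V) : Prop where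
  injective : φ.Injective
  lt : ∀ (u : bornBefore N r) (i j : Fin (N u)), i < j →
    φ (TreeEdge.child ⟨u, i⟩) < φ (TreeEdge.child ⟨u, j⟩)

/-- The `j`-th vertex of a path from the root is the image of an individual of generation at most
`j`. Before the last step this generation is below `r`, so the next vertex is again in the image.
Conversely, the ancestral line of an individual is a path of length at most `r`. -/
theorem IsLocalCopy.setOf_edist_le {N : List ℕ → ℕ} {r : ℕ} {V : Type*} {G : SimpleGraph V}
    {φ : bornUpTo N r → V} (h : IsLocalCopy N r G φ) :
    {w | G.edist (φ ⟨[], nil_mem_bornUpTo N r⟩) w ≤ r} = Set.range φ := by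
  ext w
  constructor
  · intro hw
    obtain ⟨l, hl, x, h0, h1, h2⟩ := SimpleGraph.exists_embedding_of_edist_le hw
    have key : ∀ j (hj : j ≤ l), ∃ a : bornUpTo N r, a.1.length ≤ j ∧ φ a = x ⟨j, by omega⟩ := by
      intro j
      induction j with
      | zero => exact fun _ => ⟨⟨[], nil_mem_bornUpTo N r⟩, le_rfl, h0.symm⟩
      | succ j ih =>
        intro hj
        obtain ⟨a, ha, hax⟩ := ih (by omega)
        have hadj := h2 ⟨j, by omega⟩
        change G.Adj (x ⟨j, _⟩) (x ⟨j + 1, _⟩) at hadj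
        rw [← hax] at hadj
        obtain ⟨b, hb⟩ := h.mem_range a (by omega) _ hadj
        refine ⟨b, ?_, hb⟩
        rw [← hb, h.adj_iff, parentChildGraph_adj] at hadj
        rcases hadj with ⟨i, hi⟩ | ⟨i, hi⟩
        · rw [hi, List.length_cons]; omega
        · rw [hi, List.length_cons] at ha; omega
    obtain ⟨a, -, ha⟩ := key l le_rfl
    exact ⟨a, ha.trans h1⟩
  · rintro ⟨⟨u, hu⟩, rfl⟩
    have key : ∀ u (hu : u ∈ bornUpTo N r),
        G.edist (φ ⟨[], nil_mem_bornUpTo N r⟩) (φ ⟨u, hu⟩) ≤ u.length := by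
      intro u
      induction u with
      | nil => intro _; simp
      | cons i u ih =>
        intro hu
        have hu' := bornBefore_subset N r (cons_mem_bornUpTo.1 hu).1
        have hadj : G.Adj (φ ⟨u, hu'⟩) (φ ⟨i :: u, hu⟩) :=
          (h.adj_iff _ _).2 (parentChildGraph_adj.2 (Or.inl ⟨i, rfl⟩))
        refine (G.edist_triangle (v := φ ⟨u, hu'⟩)).trans ?_
        rw [SimpleGraph.edist_eq_one_iff_adj.2 hadj, List.length_cons, Nat.cast_add, Nat.cast_one]
        exact add_le_add_left (ih hu') 1
    exact (key u hu).trans (by exact_mod_cast hu.2)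

theorem IsLocalCopy.featuredBall_eq {N : List ℕ → ℕ} {r : ℕ} {F V : Type*} [Finite V]
    {G : SimpleGraph V} {φ : bornUpTo N r → V} (h : IsLocalCopy N r G φ) (hφ : φ.Injective)
    (χ : V → F) :
    featuredBall G χ r (φ ⟨[], nil_mem_bornUpTo N r⟩) =
      FeaturedRootedGraph.of (parentChildGraph.induce (bornUpTo N r)) ⟨[], nil_mem_bornUpTo N r⟩
        (χ ∘ φ) := by
  let e : bornUpTo N r ≃ {w | G.edist (φ ⟨[], nil_mem_bornUpTo N r⟩) w ≤ r} :=
    (Equiv.ofInjective φ hφ).trans (Equiv.setCongr h.setOf_edist_le.symm)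
  symm
  exact FeaturedRootedGraph.of_eq_of_iso ⟨e, h.adj_iff _ _⟩ rfl fun _ => rfl

/-- The neighbours of an inner vertex are its children and its parent. The root needs no separate
case: `[].tail = []`, and excluding the vertex itself from its neighbours changes nothing. -/
theorem IsLocalCopy.range_child {N : List ℕ → ℕ} {r : ℕ} {V : Type*} {G : SimpleGraph V}
    {φ : bornUpTo N r → V} (h : IsLocalCopy N r G φ) (hφ : φ.Injective) {u : List ℕ}
    (hu : u ∈ bornBefore N r) (hu' : u ∈ bornUpTo N r) :
    (Set.range fun i : Fin (N u) => φ (TreeEdge.child ⟨⟨u, hu⟩, i⟩)) =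
      {w | G.Adj (φ ⟨u, hu'⟩) w ∧ w ≠ φ ⟨u.tail, tail_mem_bornUpTo hu'⟩} := by
  ext w
  constructor
  · rintro ⟨i, rfl⟩
    refine ⟨(h.adj_iff _ _).2 (parentChildGraph_adj.2 (Or.inl ⟨i, rfl⟩)), fun hc => ?_⟩
    have := congrArg (fun a => a.1.length) (hφ hc)
    simp only [TreeEdge.child, List.length_cons, List.length_tail] at this
    omega
  · rintro ⟨hadj, hne⟩
    obtain ⟨⟨b, hb⟩, rfl⟩ := h.mem_range _ hu.2 _ hadj
    rw [h.adj_iff, parentChildGraph_adj] at hadj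
    rcases hadj with ⟨i, hi⟩ | ⟨i, hi⟩
    · obtain rfl : b = i :: u := hi
      exact ⟨⟨i, (cons_mem_bornUpTo.1 hb).2⟩, rfl⟩
    · obtain rfl : u = i :: b := hi
      exact absurd rfl hne

theorem StrictMono.exists_eq_of_range_eq {α : Type*} [LinearOrder α] {a b : ℕ} {f : Fin a → α}
    {g : Fin b → α} (hf : StrictMono f) (hg : StrictMono g) (h : Set.range f = Set.range g) {i : ℕ}
    (hi : i < a) : ∃ hi' : i < b, g ⟨i, hi'⟩ = f ⟨i, hi⟩ := by
  have hab : a = b := by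
    have h1 := Set.ncard_range_of_injective hf.injective
    rw [h, Set.ncard_range_of_injective hg.injective] at h1
    simpa using h1.symm
  subst hab
  rw [hf.range_inj hg] at h
  exact ⟨hi, by rw [h]⟩

/-- Once a vertex and its parent are located, the graph determines the set of children, and the
label order determines which child is which. Even the offspring numbers are forced, so copies of
different shapes cannot share a root. -/
theorem IsLocalCopy.unique {N N' : List ℕ → ℕ} {r : ℕ} {V : Type*} [LinearOrder V]
    {G : SimpleGraph V} {φ : bornUpTo N r → V} {φ' : bornUpTo N' r → V}
    (h : IsLocalCopy N r G φ) (h' : IsLocalCopy N' r G φ') (hφ : IsSiblingIncreasing N r φ)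
    (hφ' : IsSiblingIncreasing N' r φ')
    (hroot : φ ⟨[], nil_mem_bornUpTo N r⟩ = φ' ⟨[], nil_mem_bornUpTo N' r⟩) {u : List ℕ}
    (hu : u ∈ bornUpTo N r) : ∃ hu' : u ∈ bornUpTo N' r, φ' ⟨u, hu'⟩ = φ ⟨u, hu⟩ := by
  -- The induction also carries the agreement at the parent, which `range_child` excludes from the
  -- neighbours.
  suffices key : ∀ u (hu : u ∈ bornUpTo N r),
      (∃ hu' : u ∈ bornUpTo N' r, φ' ⟨u, hu'⟩ = φ ⟨u, hu⟩) ∧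
      ∃ hu' : u.tail ∈ bornUpTo N' r, φ' ⟨u.tail, hu'⟩ = φ ⟨u.tail, tail_mem_bornUpTo hu⟩ from
    (key u hu).1
  intro u
  induction u with
  | nil => exact fun _ => ⟨⟨_, hroot.symm⟩, ⟨nil_mem_bornUpTo N' r, hroot.symm⟩⟩
  | cons i u ih =>
    intro hu
    obtain ⟨hb, hi⟩ := cons_mem_bornUpTo.1 hu
    obtain ⟨⟨hu1, e1⟩, hu2, e2⟩ := ih (bornBefore_subset N r hb)
    refine ⟨?_, hu1, e1⟩
    have hb' : u ∈ bornBefore N' r := ⟨hu1.1, hb.2⟩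
    have hr := h.range_child hφ.injective hb (bornBefore_subset N r hb)
    rw [← e1, ← e2, ← h'.range_child hφ'.injective hb' hu1] at hr
    obtain ⟨hi', e⟩ := StrictMono.exists_eq_of_range_eq (fun i j hij => hφ.lt ⟨u, hb⟩ i j hij)
      (fun i j hij => hφ'.lt ⟨u, hb'⟩ i j hij) hr hi
    exact ⟨cons_mem_bornUpTo.2 ⟨hb', hi'⟩, e⟩

/-! ### Counting sibling-increasing maps. -/

theorem card_prod_pi_orderEmbedding {ι : Type*} [Fintype ι] (k : ι → ℕ) (n : ℕ) :
    Nat.card (Fin n × ∀ u, Fin (k u) ↪o Fin n) = n * ∏ u, n.choose (k u) := by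
  rw [Nat.card_prod, Nat.card_pi, Nat.card_eq_fintype_card, Fintype.card_fin]
  congr 1
  refine Finset.prod_congr rfl fun u _ => ?_
  rw [Nat.card_congr Set.powersetCard.ofFinEmbEquiv, Set.powersetCard.card]
  simp

/-- Such a map is determined by the image of the root and, for each inner individual, the increasing
list of images of its children. -/
theorem card_isSiblingIncreasing_le (N : List ℕ → ℕ) (r n : ℕ) :
    Nat.card {φ : bornUpTo N r → Fin n // IsSiblingIncreasing N r φ} ≤
      n * ∏ u : bornBefore N r, n.choose (N u) := by
  classical
  rw [← card_prod_pi_orderEmbedding]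
  refine Nat.card_le_card_of_injective
    (fun φ => (φ.1 ⟨[], nil_mem_bornUpTo N r⟩, fun u =>
      OrderEmbedding.ofStrictMono (fun i => φ.1 (TreeEdge.child ⟨u, i⟩)) (φ.2.lt u))) ?_
  intro φ φ' h
  rw [Prod.mk.injEq] at h
  refine Subtype.ext (funext fun a => ?_)
  rcases eq_nil_or_exists_child a with rfl | ⟨⟨u, i⟩, rfl⟩
  · exact h.1
  · exact congrArg (fun f : Fin (N u) ↪o Fin n => f i) (congrFun h.2 u)

/-- A root and increasing lists of children always assemble to a map, but it may fail to be
injective. Inclusion–exclusion with the injective maps, inside the set of all maps, bounds the loss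
by the number of non-injective maps, which is of lower order. -/
theorem le_card_isSiblingIncreasing (N : List ℕ → ℕ) (r n : ℕ) :
    n * ∏ u : bornBefore N r, n.choose (N u) + n.descFactorial (Fintype.card (bornUpTo N r)) ≤
      Nat.card {φ : bornUpTo N r → Fin n // IsSiblingIncreasing N r φ} +
        n ^ Fintype.card (bornUpTo N r) := by
  classical
  let f : (Fin n × ∀ u : bornBefore N r, Fin (N u) ↪o Fin n) → bornUpTo N r → Fin n :=
    fun d a => match a with
      | ⟨[], _⟩ => d.1
      | ⟨i :: u, h⟩ => d.2 ⟨u, (cons_mem_bornUpTo.1 h).1⟩ ⟨i, (cons_mem_bornUpTo.1 h).2⟩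
  have hf : f.Injective := by
    rintro ⟨v, S⟩ ⟨v', S'⟩ h
    rw [Prod.mk.injEq]
    refine ⟨congrFun h ⟨[], nil_mem_bornUpTo N r⟩, funext fun u => ?_⟩
    ext1 i
    exact congrFun h (TreeEdge.child ⟨u, i⟩)
  let inj : Finset (bornUpTo N r → Fin n) := Finset.univ.filter Function.Injective
  let ord : Finset (bornUpTo N r → Fin n) := Finset.univ.filter (IsSiblingIncreasing N r)
  have hinj : inj.card = n.descFactorial (Fintype.card (bornUpTo N r)) := by
    rw [← Fintype.card_subtype, Fintype.card_congr (Equiv.subtypeInjectiveEquivEmbedding _ _),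
      Fintype.card_embedding_eq, Fintype.card_fin]
  have hord : ord.card = Nat.card {φ : bornUpTo N r → Fin n // IsSiblingIncreasing N r φ} := by
    rw [← Fintype.card_subtype, Nat.card_eq_fintype_card]
  have hsub : Finset.univ.image f ∩ inj ⊆ ord := by
    intro φ hφ
    obtain ⟨h1, h2⟩ := Finset.mem_inter.1 hφ
    obtain ⟨d, -, rfl⟩ := Finset.mem_image.1 h1
    exact Finset.mem_filter.2 ⟨Finset.mem_univ _, (Finset.mem_filter.1 h2).2,
      fun u i j hij => (d.2 u).strictMono hij⟩
  have hunion := Finset.card_union_add_card_inter (Finset.univ.image f) inj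
  have hle : (Finset.univ.image f ∪ inj).card ≤ n ^ Fintype.card (bornUpTo N r) := by
    refine (Finset.card_le_univ _).trans ?_
    simp
  rw [Finset.card_image_of_injective _ hf, Finset.card_univ, ← Nat.card_eq_fintype_card,
    card_prod_pi_orderEmbedding, hinj] at hunion
  have := Finset.card_le_card hsub
  rw [hord] at this
  omega

/-! ### Moments of the number of local copies. -/

instance {F : Type*} [MeasurableSpace F] (D : Measure F) [IsProbabilityMeasure D] (n : ℕ)
    (p : unitInterval) : IsProbabilityMeasure (featuredGnp D n p) := by
  unfold featuredGnp
  infer_instance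

/-- The event that `φ` is a local copy of the generations `0, …, r` with features in `A`. -/
def copyEvent {F : Type*} (N : List ℕ → ℕ) (r : ℕ) (A : Set (bornUpTo N r → F)) {n : ℕ}
    (φ : bornUpTo N r → Fin n) : Set (SimpleGraph (Fin n) × (Fin n → F)) :=
  {G | IsLocalCopy N r G φ} ×ˢ {χ | χ ∘ φ ∈ A}

section
variable {F : Type*} [MeasurableSpace F] (D : Measure F) [IsProbabilityMeasure D]

theorem measurableSet_copyEvent {N : List ℕ → ℕ} {r : ℕ} {A : Set (bornUpTo N r → F)}
    (hA : MeasurableSet A) {n : ℕ} (φ : bornUpTo N r → Fin n) :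
    MeasurableSet (copyEvent N r A φ) :=
  (measurableSet_simpleGraph _).prod
    ((show Measurable fun χ : Fin n → F => χ ∘ φ by fun_prop) hA)

theorem le_featuredGnp_real_copyEvent {N : List ℕ → ℕ} {r : ℕ} {A : Set (bornUpTo N r → F)}
    (hA : MeasurableSet A) {n : ℕ} (p : unitInterval) {φ : bornUpTo N r → Fin n}
    (hφ : φ.Injective) :
    (p : ℝ) ^ Fintype.card (TreeEdge N r) *
        (1 - p : ℝ) ^ (Fintype.card (bornBefore N r) * n + Fintype.card (bornUpTo N r) ^ 2) *
        (Measure.pi fun _ => D).real A ≤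
      (featuredGnp D n p).real (copyEvent N r A φ) := by
  rw [featuredGnp, copyEvent, measureReal_prod_prod, pi_real_comp_mem D hφ hA]
  refine mul_le_mul_of_nonneg_right ?_ measureReal_nonneg
  have h := le_binomialRandom_real_pattern p hφ
    (e := fun e : TreeEdge N r => (e.parent, e.child)) TreeEdge.sym2_injective
    TreeEdge.parent_ne_child
    (fun u : bornBefore N r => (⟨u, bornBefore_subset N r u.2⟩ : bornUpTo N r))
  rw [Fintype.card_fin] at h
  refine h.trans (measureReal_mono ?_ (measure_ne_top _ _))
  rintro G ⟨h1, h2⟩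
  exact ⟨fun a b => (h1 a b).trans (parentChildGraph_adj_iff_exists_edge a b).symm,
    fun a ha w hw => h2 ⟨a.1, a.2.1, ha⟩ w hw⟩

/-- Of the two copies only the tree edges and the absence of edges from inner vertices to outside
the union are kept; forgetting the non-edges within the union enlarges the event. -/
theorem featuredGnp_real_copyEvent_inter_le {N : List ℕ → ℕ} {r : ℕ} {A : Set (bornUpTo N r → F)}
    (hA : MeasurableSet A) {n : ℕ} (p : unitInterval) {φ φ' : bornUpTo N r → Fin n}
    (hφ : (Sum.elim φ φ').Injective) :
    (featuredGnp D n p).real (copyEvent N r A φ ∩ copyEvent N r A φ') ≤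
      (p : ℝ) ^ (2 * Fintype.card (TreeEdge N r)) *
        (1 - p : ℝ) ^ (2 * Fintype.card (bornBefore N r) * (n - 2 * Fintype.card (bornUpTo N r))) *
        (Measure.pi fun _ => D).real A ^ 2 := by
  have h2 : ({χ | χ ∘ φ ∈ A} ∩ {χ | χ ∘ φ' ∈ A} : Set (Fin n → F)) =
    {χ | χ ∘ φ ∈ A ∧ χ ∘ φ' ∈ A} := rfl
  rw [featuredGnp, copyEvent, copyEvent, Set.prod_inter_prod, measureReal_prod_prod, h2,
    pi_real_comp_mem_and_comp_mem D hφ hA]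
  refine mul_le_mul_of_nonneg_right ?_ (sq_nonneg _)
  have h := binomialRandom_real_pattern p hφ
    (e := Sum.elim (fun e : TreeEdge N r => (Sum.inl e.parent, Sum.inl e.child))
      (fun e : TreeEdge N r => (Sum.inr e.parent, Sum.inr e.child))) (by
        rintro (e | e) (e' | e') h
        · refine congrArg Sum.inl (TreeEdge.sym2_injective ?_)
          simpa using h
        · simp at h
        · simp at h
        · refine congrArg Sum.inr (TreeEdge.sym2_injective ?_)
          simpa using h) (by
        rintro (e | e)
        · simpa using e.parent_ne_child
        · simpa using e.parent_ne_child)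
    (ι := Sum.map (fun u : bornBefore N r => (⟨u, bornBefore_subset N r u.2⟩ : bornUpTo N r))
      (fun u : bornBefore N r => (⟨u, bornBefore_subset N r u.2⟩ : bornUpTo N r))) (by
        refine Function.Injective.sumMap ?_ ?_ <;>
        exact fun a b h => Subtype.ext (congrArg (fun x : bornUpTo N r => x.1) h))
  simp only [Fintype.card_sum, Fintype.card_fin, ← two_mul] at h
  refine le_trans (measureReal_mono ?_ (measure_ne_top _ _)) h.le
  rintro G ⟨h1, h2⟩
  refine ⟨?_, ?_⟩
  · rintro (e | e)
    · exact (h1.adj_iff _ _).2 ((parentChildGraph_adj_iff_exists_edge _ _).2 ⟨e, rfl⟩)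
    · exact (h2.adj_iff _ _).2 ((parentChildGraph_adj_iff_exists_edge _ _).2 ⟨e, rfl⟩)
  · rintro (u | u) w hw hadj
    · obtain ⟨a, ha⟩ := h1.mem_range _ u.2.2 _ hadj
      exact hw ⟨Sum.inl a, ha⟩
    · obtain ⟨a, ha⟩ := h2.mem_range _ u.2.2 _ hadj
      exact hw ⟨Sum.inr a, ha⟩

/-- The root of a mapped tree. -/
def mappedRoot {N : List ℕ → ℕ} {r : ℕ} {V : Type*} (φ : bornUpTo N r → V) : V :=
  φ ⟨[], nil_mem_bornUpTo N r⟩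

theorem IsLocalCopy.eq_of_mappedRoot_eq {N : List ℕ → ℕ} {r : ℕ} {V : Type*} [LinearOrder V]
    {G : SimpleGraph V} {φ φ' : bornUpTo N r → V} (h : IsLocalCopy N r G φ)
    (h' : IsLocalCopy N r G φ') (hφ : IsSiblingIncreasing N r φ)
    (hφ' : IsSiblingIncreasing N r φ') (hroot : mappedRoot φ = mappedRoot φ') : φ = φ' := by
  funext u
  obtain ⟨_, h1⟩ := h.unique h' hφ hφ' hroot u.2
  exact h1.symm

theorem IsLocalCopy.edist_mappedRoot_le {N : List ℕ → ℕ} {r : ℕ} {V : Type*}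
    {G : SimpleGraph V} {φ φ' : bornUpTo N r → V} (h : IsLocalCopy N r G φ)
    (h' : IsLocalCopy N r G φ') {a b : bornUpTo N r} (hab : φ a = φ' b) :
    G.edist (mappedRoot φ) (mappedRoot φ') ≤ (2 * r : ℕ) := by
  have h1 : φ a ∈ {w | G.edist (mappedRoot φ) w ≤ r} := by
    rw [mappedRoot, h.setOf_edist_le]; exact ⟨a, rfl⟩
  have h2 : φ' b ∈ {w | G.edist (mappedRoot φ') w ≤ r} := by
    rw [mappedRoot, h'.setOf_edist_le]; exact ⟨b, rfl⟩
  refine (G.edist_triangle (v := φ a)).trans ?_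
  rw [G.edist_comm (u := φ a), two_mul, Nat.cast_add]
  exact add_le_add h1 (hab ▸ h2)

/-- No overlap patterns are enumerated. For a fixed pair of roots the events are pairwise disjoint
by uniqueness, and each forces the roots within distance `2 * r`, so their total probability is at
most that of this distance event. -/
theorem sum_featuredGnp_real_copyEvent_inter_le {N : List ℕ → ℕ} {r : ℕ}
    {A : Set (bornUpTo N r → F)} (hA : MeasurableSet A) (n : ℕ) (p : unitInterval)
    [Fintype {φ : bornUpTo N r → Fin n // IsSiblingIncreasing N r φ}]
    (S : Finset ({φ : bornUpTo N r → Fin n // IsSiblingIncreasing N r φ} ×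
      {φ : bornUpTo N r → Fin n // IsSiblingIncreasing N r φ}))
    (hS : ∀ x ∈ S, ¬ (Sum.elim x.1.1 x.2.1).Injective) :
    ∑ x ∈ S, (featuredGnp D n p).real (copyEvent N r A x.1.1 ∩ copyEvent N r A x.2.1) ≤
      n * ∑ l ∈ Finset.range (2 * r + 1), (n * p : ℝ) ^ l := by
  classical
  have hb := sum_binomialRandom_real_edist_le (V := Fin n) p (2 * r)
  rw [Fintype.card_fin] at hb
  refine le_trans ?_ hb
  rw [← Fintype.sum_prod_type',
    ← Finset.sum_fiberwise S (fun x => (mappedRoot x.1.1, mappedRoot x.2.1))]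
  refine Finset.sum_le_sum ?_
  rintro ⟨v, w⟩ -
  rw [← measureReal_biUnion_finset]
  · have : (SimpleGraph.binomialRandom (Fin n) p).real {G | G.edist v w ≤ (2 * r : ℕ)} =
        (featuredGnp D n p).real ({G : SimpleGraph (Fin n) | G.edist v w ≤ (2 * r : ℕ)} ×ˢ Set.univ) := by
      rw [featuredGnp, measureReal_prod_prod]
      simp
    rw [this]
    refine measureReal_mono (Set.iUnion₂_subset fun x hx => ?_) (measure_ne_top _ _)
    obtain ⟨hxS, hx⟩ := Finset.mem_filter.1 hx
    rw [Prod.mk.injEq] at hx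
    rintro ω ⟨h1, h2⟩
    refine ⟨?_, trivial⟩
    have hn := hS x hxS
    rw [Sum.elim_injective] at hn
    have : ∃ a b, x.1.1 a = x.2.1 b := by
      by_contra! hc
      exact hn ⟨x.1.2.injective, x.2.2.injective, hc⟩
    obtain ⟨a, b, hab⟩ := this
    have := IsLocalCopy.edist_mappedRoot_le h1.1 h2.1 hab
    rw [hx.1, hx.2] at this
    exact this
  · rintro x hx y hy hxy
    have hx' := (Finset.mem_filter.1 hx).2
    have hy' := (Finset.mem_filter.1 hy).2
    rw [Prod.mk.injEq] at hx' hy'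
    refine Set.disjoint_left.2 fun ω hω hω' => hxy ?_
    refine Prod.ext (Subtype.ext ?_) (Subtype.ext ?_)
    · exact IsLocalCopy.eq_of_mappedRoot_eq hω.1.1 hω'.1.1 x.1.2 y.1.2 (hx'.1.trans hy'.1.symm)
    · exact IsLocalCopy.eq_of_mappedRoot_eq hω.2.1 hω'.2.1 x.2.2 y.2.2 (hx'.2.trans hy'.2.symm)
  · exact fun x _ => (measurableSet_copyEvent hA _).inter (measurableSet_copyEvent hA _)

theorem sum_sum_featuredGnp_real_copyEvent_inter_le {N : List ℕ → ℕ} {r : ℕ}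
    {A : Set (bornUpTo N r → F)} (hA : MeasurableSet A) (n : ℕ) (p : unitInterval)
    [Fintype {φ : bornUpTo N r → Fin n // IsSiblingIncreasing N r φ}] :
    ∑ φ : {φ : bornUpTo N r → Fin n // IsSiblingIncreasing N r φ},
      ∑ φ' : {φ : bornUpTo N r → Fin n // IsSiblingIncreasing N r φ},
        (featuredGnp D n p).real (copyEvent N r A φ.1 ∩ copyEvent N r A φ'.1) ≤
      ((n : ℝ) * ∏ u : bornBefore N r, (n.choose (N u) : ℝ)) ^ 2 *
      ((p : ℝ) ^ (2 * Fintype.card (TreeEdge N r)) *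
        (1 - p : ℝ) ^ (2 * Fintype.card (bornBefore N r) * (n - 2 * Fintype.card (bornUpTo N r))) *
        (Measure.pi fun _ => D).real A ^ 2) +
      n * ∑ l ∈ Finset.range (2 * r + 1), (n * p : ℝ) ^ l := by
  classical
  have hp0 : (0 : ℝ) ≤ p := p.2.1
  have hp1 : (0 : ℝ) ≤ 1 - p := sub_nonneg.2 p.2.2
  rw [← Fintype.sum_prod_type', ← Finset.sum_filter_add_sum_filter_not Finset.univ
    (fun x => (Sum.elim x.1.1 x.2.1).Injective)]
  refine add_le_add ?_ (sum_featuredGnp_real_copyEvent_inter_le D hA n p _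
    fun x hx => (Finset.mem_filter.1 hx).2)
  refine (Finset.sum_le_sum fun x hx => featuredGnp_real_copyEvent_inter_le D hA p
    (Finset.mem_filter.1 hx).2).trans ?_
  rw [Finset.sum_const, nsmul_eq_mul]
  refine mul_le_mul_of_nonneg_right ?_ (by positivity)
  have h1 := card_isSiblingIncreasing_le N r n
  have h2 : (Finset.univ.filter fun x : {φ : bornUpTo N r → Fin n // IsSiblingIncreasing N r φ} ×
      {φ : bornUpTo N r → Fin n // IsSiblingIncreasing N r φ} =>
      (Sum.elim x.1.1 x.2.1).Injective).card ≤ (n * ∏ u : bornBefore N r, n.choose (N u)) ^ 2 := by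
    refine (Finset.card_filter_le _ _).trans ?_
    rw [Finset.card_univ, Fintype.card_prod, ← Nat.card_eq_fintype_card, sq]
    exact Nat.mul_le_mul h1 h1
  exact_mod_cast h2

theorem le_sum_featuredGnp_real_copyEvent {N : List ℕ → ℕ} {r : ℕ}
    {A : Set (bornUpTo N r → F)} (hA : MeasurableSet A) (n : ℕ) (p : unitInterval)
    [Fintype {φ : bornUpTo N r → Fin n // IsSiblingIncreasing N r φ}] :
    ((n : ℝ) * ∏ u : bornBefore N r, (n.choose (N u) : ℝ) +
        n.descFactorial (Fintype.card (bornUpTo N r)) - (n : ℝ) ^ Fintype.card (bornUpTo N r)) *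
      ((p : ℝ) ^ Fintype.card (TreeEdge N r) *
        (1 - p : ℝ) ^ (Fintype.card (bornBefore N r) * n + Fintype.card (bornUpTo N r) ^ 2) *
        (Measure.pi fun _ => D).real A) ≤
    ∑ φ : {φ : bornUpTo N r → Fin n // IsSiblingIncreasing N r φ},
        (featuredGnp D n p).real (copyEvent N r A φ.1) := by
  have hp0 : (0 : ℝ) ≤ p := p.2.1
  have hp1 : (0 : ℝ) ≤ 1 - p := sub_nonneg.2 p.2.2
  refine le_trans ?_ (Finset.sum_le_sum fun φ _ =>
    le_featuredGnp_real_copyEvent D hA p φ.2.injective)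
  rw [Finset.sum_const, nsmul_eq_mul]
  refine mul_le_mul_of_nonneg_right ?_ (by positivity)
  have h := le_card_isSiblingIncreasing N r n
  rw [Nat.card_eq_fintype_card] at h
  rw [Finset.card_univ, sub_le_iff_le_add]
  exact_mod_cast h

end

/-! ### Asymptotics of the moment bounds. -/

theorem tendsto_choose_div_pow (k : ℕ) :
    Tendsto (fun n : ℕ => (n.choose k : ℝ) / (n : ℝ) ^ k) atTop (𝓝 (1 / k.factorial)) := by
  have h := (isEquivalent_choose k)
  rw [Asymptotics.isEquivalent_iff_tendsto_one] at h
  · have h2 := h.mul_const (1 / (k.factorial : ℝ))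
    rw [one_mul] at h2
    refine h2.congr' ?_
    filter_upwards [eventually_gt_atTop 0] with n hn
    have : (n : ℝ) ≠ 0 := by positivity
    have : (k.factorial : ℝ) ≠ 0 := by positivity
    simp only [Pi.div_apply]
    field_simp
  · filter_upwards [eventually_gt_atTop 0] with n hn
    positivity

theorem tendsto_descFactorial_div_pow (k : ℕ) :
    Tendsto (fun n : ℕ => (n.descFactorial k : ℝ) / (n : ℝ) ^ k) atTop (𝓝 1) := by
  have h := (isEquivalent_descFactorial k)
  rw [Asymptotics.isEquivalent_iff_tendsto_one] at h
  · exact h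
  · filter_upwards [eventually_gt_atTop 0] with n hn
    positivity

section
variable {p : ℕ → ℝ} {c : ℝ} (hp : ∀ᶠ n : ℕ in atTop, n * p n = c)
include hp

theorem tendsto_of_eventually_mul_eq : Tendsto p atTop (𝓝 0) := by
  refine (tendsto_const_div_atTop_nhds_zero_nat c).congr' ?_
  filter_upwards [hp, eventually_gt_atTop 0] with n hn hn0
  rw [← hn]
  field_simp

theorem tendsto_one_sub_pow_self :
    Tendsto (fun n => (1 - p n) ^ n) atTop (𝓝 (Real.exp (-c))) := by
  have : Tendsto (fun n : ℕ => (n : ℝ) * (-p n)) atTop (𝓝 (-c)) := by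
    refine tendsto_const_nhds.congr' ?_
    filter_upwards [hp] with n hn
    rw [mul_neg, hn]
  simpa only [sub_eq_add_neg] using Real.tendsto_one_add_pow_exp_of_tendsto this

theorem tendsto_one_sub_pow_const (k : ℕ) :
    Tendsto (fun n => (1 - p n) ^ k) atTop (𝓝 1) := by
  simpa using ((tendsto_of_eventually_mul_eq hp).const_sub 1).pow k

theorem tendsto_one_sub_pow_sub (k : ℕ) :
    Tendsto (fun n => (1 - p n) ^ (n - k)) atTop (𝓝 (Real.exp (-c))) := by
  have h := (tendsto_one_sub_pow_self hp).div (tendsto_one_sub_pow_const hp k) one_ne_zero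
  rw [div_one] at h
  refine h.congr' ?_
  have h1 : ∀ᶠ n in atTop, p n < 1 :=
    (tendsto_of_eventually_mul_eq hp).eventually_lt_const one_pos
  filter_upwards [h1, eventually_ge_atTop k] with n hn hk
  rw [Pi.div_apply, pow_sub₀ _ (by linarith) hk, div_eq_mul_inv]

end

/-- The probability that the first `r` generations of the branching process have the offspring
numbers `N` and features in `A`. -/
noncomputable def fbpShapeProb {F : Type*} [MeasurableSpace F] (c : ℝ≥0) (D : Measure F)
    (N : List ℕ → ℕ) (r : ℕ) (A : Set (bornUpTo N r → F)) : ℝ :=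
  (∏ u : bornBefore N r, (poissonMeasure c).real {N u}) * (Measure.pi fun _ => D).real A

section
variable {F : Type*} [MeasurableSpace F] (D : Measure F) (c : ℝ≥0) (N : List ℕ → ℕ) (r : ℕ)
  (A : Set (bornUpTo N r → F))

theorem fbpShapeProb_eq : fbpShapeProb c D N r A =
    (∏ u : bornBefore N r, (1 / ((N u).factorial : ℝ))) * (c : ℝ) ^ Fintype.card (TreeEdge N r) *
      Real.exp (-c) ^ Fintype.card (bornBefore N r) * (Measure.pi fun _ => D).real A := by
  have hcard : Fintype.card (TreeEdge N r) = ∑ u : bornBefore N r, N u := by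
    rw [Fintype.card_sigma]
    simp
  rw [fbpShapeProb, hcard, ← Finset.prod_pow_eq_pow_sum, ← Finset.card_univ,
    ← Finset.prod_const, ← Finset.prod_mul_distrib, ← Finset.prod_mul_distrib]
  congr 1
  refine Finset.prod_congr rfl fun u _ => ?_
  rw [poissonMeasure_real_singleton]
  ring

theorem tendsto_prod_choose_div_pow :
    Tendsto (fun n : ℕ => (∏ u : bornBefore N r, (n.choose (N u) : ℝ)) /
      (n : ℝ) ^ Fintype.card (TreeEdge N r)) atTop
      (𝓝 (∏ u : bornBefore N r, (1 / ((N u).factorial : ℝ)))) := by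
  have hcard : Fintype.card (TreeEdge N r) = ∑ u : bornBefore N r, N u := by
    rw [Fintype.card_sigma]
    simp
  refine (tendsto_finsetProd Finset.univ fun (u : bornBefore N r) _ =>
    tendsto_choose_div_pow (N u)).congr fun n => ?_
  rw [Finset.prod_div_distrib, hcard, ← Finset.prod_pow_eq_pow_sum]

variable {c} {p : ℕ → ℝ} (hp : ∀ᶠ n : ℕ in atTop, n * p n = c)
include hp

/-- The correction `descFactorial - n ^ k` is `o(n ^ k)`, and with `k` one more than the number of
edges it vanishes after multiplication by `p ^ (k - 1) / n`. -/
theorem tendsto_firstMoment_bound :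
    Tendsto (fun n : ℕ => ((n : ℝ) * ∏ u : bornBefore N r, (n.choose (N u) : ℝ) +
        n.descFactorial (Fintype.card (bornUpTo N r)) - (n : ℝ) ^ Fintype.card (bornUpTo N r)) *
      ((p n) ^ Fintype.card (TreeEdge N r) *
        (1 - p n) ^ (Fintype.card (bornBefore N r) * n + Fintype.card (bornUpTo N r) ^ 2) *
        (Measure.pi fun _ => D).real A) * (1 / n : ℝ)) atTop (𝓝 (fbpShapeProb c D N r A)) := by
  rw [fbpShapeProb_eq]
  have h1 := (((tendsto_prod_choose_div_pow N r).add
    (tendsto_descFactorial_div_pow (Fintype.card (bornUpTo N r)))).sub_const 1)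
  rw [add_sub_cancel_right] at h1
  have h2 := (tendsto_one_sub_pow_self hp).pow (Fintype.card (bornBefore N r))
  have h3 := tendsto_one_sub_pow_const hp (Fintype.card (bornUpTo N r) ^ 2)
  have h := (((h1.mul_const ((c : ℝ) ^ Fintype.card (TreeEdge N r))).mul (h2.mul h3)).mul_const
    ((Measure.pi fun _ => D).real A))
  rw [mul_one] at h
  refine h.congr' ?_
  filter_upwards [hp, eventually_gt_atTop 0] with n hn hn0
  have : (n : ℝ) ≠ 0 := by positivity
  rw [card_bornUpTo, ← hn, pow_add (1 - p n), mul_comm (Fintype.card (bornBefore N r)) n,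
    pow_mul (1 - p n), mul_pow, pow_succ]
  field_simp

/-- The main term tends to the square of the first moment limit; the overlapping pairs contribute a
constant times `n / n ^ 2`. -/
theorem tendsto_secondMoment_bound :
    Tendsto (fun n : ℕ => (((n : ℝ) * ∏ u : bornBefore N r, (n.choose (N u) : ℝ)) ^ 2 *
      ((p n) ^ (2 * Fintype.card (TreeEdge N r)) *
        (1 - p n) ^ (2 * Fintype.card (bornBefore N r) *
          (n - 2 * Fintype.card (bornUpTo N r))) *
        (Measure.pi fun _ => D).real A ^ 2) +
      n * ∑ l ∈ Finset.range (2 * r + 1), (n * p n) ^ l) * (1 / n : ℝ) ^ 2) atTop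
      (𝓝 (fbpShapeProb c D N r A ^ 2)) := by
  rw [fbpShapeProb_eq]
  have h1 := ((tendsto_prod_choose_div_pow N r).mul_const
    ((c : ℝ) ^ Fintype.card (TreeEdge N r)))
  have h2 := (tendsto_one_sub_pow_sub hp (2 * Fintype.card (bornUpTo N r))).pow
    (Fintype.card (bornBefore N r))
  have h3 := ((h1.mul h2).mul_const ((Measure.pi fun _ => D).real A)).pow 2
  have h4 := tendsto_const_div_atTop_nhds_zero_nat
    (∑ l ∈ Finset.range (2 * r + 1), (c : ℝ) ^ l)
  have h := h3.add h4
  rw [add_zero] at h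
  refine h.congr' ?_
  filter_upwards [hp, eventually_gt_atTop 0] with n hn hn0
  have : (n : ℝ) ≠ 0 := by positivity
  have e1 : p n ^ (2 * Fintype.card (TreeEdge N r)) = (p n ^ Fintype.card (TreeEdge N r)) ^ 2 := by
    rw [mul_comm, pow_mul]
  have e2 : ∀ x : ℕ, (1 - p n) ^ (2 * Fintype.card (bornBefore N r) * x) =
      (((1 - p n) ^ x) ^ Fintype.card (bornBefore N r)) ^ 2 := fun x => by
    rw [← pow_mul, ← pow_mul]
    congr 1
    ring
  rw [e1, e2, ← hn, mul_pow (n : ℝ) (p n) (Fintype.card _)]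
  field_simp

end

/-! ### Concentration for a single shape. -/

theorem eventually_mul_projIcc_eq (c : ℝ≥0) :
    ∀ᶠ n : ℕ in atTop,
      (n : ℝ) * (Set.projIcc (0 : ℝ) 1 zero_le_one ((c : ℝ) / n) : ℝ) = c := by
  filter_upwards [eventually_gt_atTop 0, eventually_ge_atTop ⌈c⌉₊] with n hn hc
  have h0 : (0 : ℝ) < n := by exact_mod_cast hn
  have h1 : (c : ℝ) ≤ n := by exact_mod_cast Nat.ceil_le.1 hc
  rw [Set.projIcc_of_mem zero_le_one ⟨by positivity, (div_le_one h0).2 h1⟩]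
  field_simp

theorem tendsto_measureReal_copyCount_lt {F : Type*} [MeasurableSpace F] (D : Measure F)
    [IsProbabilityMeasure D] (c : ℝ≥0) {N : List ℕ → ℕ} {r : ℕ} {A : Set (bornUpTo N r → F)}
    (hA : MeasurableSet A) {δ : ℝ} (hδ : 0 < δ) :
    Tendsto (fun n : ℕ =>
      (featuredGnp D n (Set.projIcc (0 : ℝ) 1 zero_le_one ((c : ℝ) / n))).real
        {ω | (Set.ncard {φ : {φ : bornUpTo N r → Fin n // IsSiblingIncreasing N r φ} |
          ω ∈ copyEvent N r A φ.1} : ℝ) * (1 / n : ℝ) < fbpShapeProb c D N r A - δ})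
      atTop (𝓝 0) := by
  classical
  have hp := eventually_mul_projIcc_eq c
  have h1 := tendsto_firstMoment_bound D N r A hp
  have h2 := tendsto_secondMoment_bound D N r A hp
  have hq : 0 ≤ fbpShapeProb c D N r A :=
    mul_nonneg (Finset.prod_nonneg fun _ _ => measureReal_nonneg) measureReal_nonneg
  have h := ((h2.sub (h1.const_mul (2 * fbpShapeProb c D N r A))).add_const
    (fbpShapeProb c D N r A ^ 2)).div_const (δ ^ 2)
  -- The Chebyshev bound vanishes in the limit, since the first moment bound tends to `q` and the
  -- second to `q ^ 2`.
  rw [show (fbpShapeProb c D N r A ^ 2 - 2 * fbpShapeProb c D N r A * fbpShapeProb c D N r A +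
    fbpShapeProb c D N r A ^ 2) / δ ^ 2 = 0 by ring] at h
  refine squeeze_zero (fun _ => measureReal_nonneg) (fun n => ?_) h
  let _ : Fintype {φ : bornUpTo N r → Fin n // IsSiblingIncreasing N r φ} := Fintype.ofFinite _
  exact measureReal_count_lt_le
    (E := fun φ : {φ : bornUpTo N r → Fin n // IsSiblingIncreasing N r φ} => copyEvent N r A φ.1)
    (featuredGnp D n (Set.projIcc (0 : ℝ) 1 zero_le_one ((c : ℝ) / n)))
    (fun φ => measurableSet_copyEvent hA φ.1) hq hδ
    (mul_le_mul_of_nonneg_right (le_sum_featuredGnp_real_copyEvent D hA n _) (by positivity))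
    (mul_le_mul_of_nonneg_right (sum_sum_featuredGnp_real_copyEvent_inter_le D hA n _)
      (by positivity))

/-! ### From copies of shapes to vertices with ball in `𝒯`. -/

/-- The feature assignments for which the generations `0, …, r` belong to `𝒯`. -/
def shapeFeatures {F : Type*} (N : List ℕ → ℕ) (r : ℕ) (𝒯 : Set (FeaturedRootedGraph F)) :
    Set (bornUpTo N r → F) :=
  {χ | FeaturedRootedGraph.of (parentChildGraph.induce (bornUpTo N r))
    ⟨[], nil_mem_bornUpTo N r⟩ χ ∈ 𝒯}

theorem measurableSet_shapeFeatures {F : Type*} [MeasurableSpace F] (N : List ℕ → ℕ) (r : ℕ)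
    {𝒯 : Set (FeaturedRootedGraph F)} (h𝒯 : MeasurableSet 𝒯) :
    MeasurableSet (shapeFeatures N r 𝒯) :=
  FeaturedRootedGraph.measurable_of _ _ h𝒯

/-- Each copy makes its root a vertex with ball in `𝒯`. By uniqueness a vertex is the root of at
most one copy, over all the shapes together. -/
theorem sum_ncard_copyEvent_le {F J : Type*} [Fintype J] {N : J → List ℕ → ℕ} {r : ℕ}
    (hN : Function.Injective fun j => bornUpTo (N j) r) (𝒯 : Set (FeaturedRootedGraph F)) {n : ℕ}
    (ω : SimpleGraph (Fin n) × (Fin n → F)) :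
    ∑ j, Set.ncard {φ : {φ : bornUpTo (N j) r → Fin n // IsSiblingIncreasing (N j) r φ} |
      ω ∈ copyEvent (N j) r (shapeFeatures (N j) r 𝒯) φ.1} ≤
      Set.ncard {v : Fin n | featuredBall ω.1 ω.2 r v ∈ 𝒯} := by
  let S : ∀ j, Set {φ : bornUpTo (N j) r → Fin n // IsSiblingIncreasing (N j) r φ} :=
    fun j => {φ | ω ∈ copyEvent (N j) r (shapeFeatures (N j) r 𝒯) φ.1}
  have hmem : ∀ x : Σ j, S j, mappedRoot x.2.1.1 ∈ {v : Fin n | featuredBall ω.1 ω.2 r v ∈ 𝒯} := by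
    rintro ⟨j, φ, h1, h2⟩
    change featuredBall ω.1 ω.2 r _ ∈ 𝒯
    rw [mappedRoot, IsLocalCopy.featuredBall_eq h1 φ.2.injective]
    exact h2
  simp only [← Nat.card_coe_set_eq]
  rw [← Nat.card_sigma]
  refine Nat.card_le_card_of_injective (fun x : Σ j, S j => ⟨_, hmem x⟩) ?_
  rintro ⟨j, φ, h1, _⟩ ⟨j', φ', h1', _⟩ h
  have hroot : mappedRoot φ.1 = mappedRoot φ'.1 := congrArg Subtype.val h
  have hj : j = j' := hN (Set.Subset.antisymm
    (fun u hu => (IsLocalCopy.unique h1 h1' φ.2 φ'.2 hroot hu).1)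
    (fun u hu => (IsLocalCopy.unique h1' h1 φ'.2 φ.2 hroot.symm hu).1))
  subst hj
  obtain rfl : φ = φ' :=
    Subtype.ext (IsLocalCopy.eq_of_mappedRoot_eq h1 h1' φ.2 φ'.2 hroot)
  rfl

/-! ### Shapes of the branching process. -/

theorem truncatedTree_congr {F : Type*} {r : ℕ} {N N' : List ℕ → ℕ} (h : bornUpTo N r = bornUpTo N' r)
    (χ : List ℕ → F) : truncatedTree r N χ = truncatedTree r N' χ := by
  refine FeaturedRootedGraph.of_eq_of_iso ⟨Equiv.setCongr h, Iff.rfl⟩ rfl fun _ => rfl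

section
variable {F : Type*} [MeasurableSpace F] (c : ℝ≥0) (D : Measure F) [IsProbabilityMeasure D]

instance : IsProbabilityMeasure (fbpMeasure c D) := by
  unfold fbpMeasure
  infer_instance

/-- The set of individuals up to generation `r` fixes the offspring numbers of all earlier
generations, which are independent of each other and of the features. -/
theorem fbpMeasure_real_bornUpTo_eq_le (N : List ℕ → ℕ) (r : ℕ)
    {𝒯 : Set (FeaturedRootedGraph F)} (h𝒯 : MeasurableSet 𝒯) :
    (fbpMeasure c D).real
      {ω | bornUpTo ω.1 r = bornUpTo N r ∧ truncatedTree r ω.1 ω.2 ∈ 𝒯} ≤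
      fbpShapeProb c D N r (shapeFeatures N r 𝒯) := by
  classical
  let s : Finset (List ℕ) := (bornBefore N r).toFinset
  have hsub : {ω : (List ℕ → ℕ) × (List ℕ → F) |
      bornUpTo ω.1 r = bornUpTo N r ∧ truncatedTree r ω.1 ω.2 ∈ 𝒯} ⊆
      ((s : Set (List ℕ)).pi fun u => {N u}) ×ˢ
        {χ | (fun u : bornUpTo N r => χ u) ∈ shapeFeatures N r 𝒯} := by
    rintro ⟨N', χ⟩ ⟨h1, h2⟩
    refine ⟨fun u hu => ?_, ?_⟩
    · have hb : u ∈ bornBefore N r := by simpa [s] using hu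
      have hb' : u ∈ bornBefore N' r :=
        ⟨(h1.symm ▸ bornBefore_subset N r hb : u ∈ bornUpTo N' r).1, hb.2⟩
      have key : ∀ i, i < N' u ↔ i < N u := fun i => by
        have := Set.ext_iff.1 h1 (i :: u)
        rw [cons_mem_bornUpTo, cons_mem_bornUpTo] at this
        simpa [hb, hb'] using this
      exact le_antisymm (not_lt.1 fun h => lt_irrefl _ ((key _).1 h))
        (not_lt.1 fun h => lt_irrefl _ ((key _).2 h))
    · rw [truncatedTree_congr h1] at h2
      exact h2
  refine (measureReal_mono hsub (measure_ne_top _ _)).trans ?_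
  rw [fbpMeasure, measureReal_prod_prod,
    infinitePi_real_restrict_mem D _ (measurableSet_shapeFeatures N r h𝒯), fbpShapeProb]
  refine mul_le_mul_of_nonneg_right (le_of_eq ?_) measureReal_nonneg
  rw [measureReal_def, Measure.infinitePi_pi _ fun _ _ => .of_discrete, ENNReal.toReal_prod]
  exact (Finset.prod_subtype s (by simp [s]) fun u => (poissonMeasure c).real {N u})

theorem measurableSet_mem_bornUpTo (u : List ℕ) (r : ℕ) :
    MeasurableSet {N : List ℕ → ℕ | u ∈ bornUpTo N r} := by
  have h : MeasurableSet {N : List ℕ → ℕ | IsBorn N u} := by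
    induction u with
    | nil => exact MeasurableSet.univ
    | cons i u ih => exact ih.inter (measurableSet_lt measurable_const (measurable_pi_apply u))
  exact h.inter (MeasurableSet.const _)

/-- The set of individuals is a random element of the countable type `Finset (List ℕ)`, so the
values with large code have small probability. -/
theorem exists_finite_shapes (r : ℕ) {δ : ℝ} (hδ : 0 < δ) :
    ∃ (J : Type) (_ : Fintype J) (N : J → List ℕ → ℕ),
      (Function.Injective fun j => bornUpTo (N j) r) ∧
      (fbpMeasure c D).real {ω | ∀ j, bornUpTo ω.1 r ≠ bornUpTo (N j) r} < δ := by
  classical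
  let f : (List ℕ → ℕ) × (List ℕ → F) → Finset (List ℕ) := fun ω => (bornUpTo_finite ω.1 r).toFinset
  let _ : MeasurableSpace (Finset (List ℕ)) := ⊤
  have hf : Measurable f := by
    refine measurable_to_countable' fun s => ?_
    have : f ⁻¹' {s} = ⋂ u, {ω | u ∈ bornUpTo ω.1 r ↔ u ∈ s} := by
      ext ω
      simp [f, Finset.ext_iff]
    rw [this]
    refine MeasurableSet.iInter fun u => ?_
    have hu : MeasurableSet {ω : (List ℕ → ℕ) × (List ℕ → F) | u ∈ bornUpTo ω.1 r} :=
      measurable_fst (measurableSet_mem_bornUpTo u r)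
    by_cases hus : u ∈ s
    · simpa [hus] using hu
    · simp only [hus, iff_false]
      exact hu.compl
  let B : ℕ → Set ((List ℕ → ℕ) × (List ℕ → F)) := fun m => {ω | m ≤ Encodable.encode (f ω)}
  have hB : ∀ m, MeasurableSet (B m) := fun m =>
    hf (t := {s | m ≤ Encodable.encode s}) trivial
  have hlim := tendsto_measure_iInter_atTop (μ := fbpMeasure c D) (s := B)
    (fun m => (hB m).nullMeasurableSet) (fun m m' h ω hω => h.trans hω) ⟨0, measure_ne_top _ _⟩
  have hemp : ⋂ m, B m = ∅ := by
    refine Set.eq_empty_of_forall_notMem fun ω hω => ?_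
    have := Set.mem_iInter.1 hω (Encodable.encode (f ω) + 1)
    exact absurd this (by simp [B])
  rw [hemp, measure_empty] at hlim
  have hlim' := (ENNReal.tendsto_toReal ENNReal.zero_ne_top).comp hlim
  obtain ⟨m, hm⟩ := (hlim'.eventually_lt_const (by simpa using hδ)).exists
  let K : Set (Finset (List ℕ)) :=
    {s | Encodable.encode s < m ∧ ∃ N, (bornUpTo_finite N r).toFinset = s}
  have hK : K.Finite := ((Set.finite_Iio m).preimage Encodable.encode_injective.injOn).subset
    fun s hs => hs.1
  refine ⟨K, hK.fintype, fun j => j.2.2.choose, fun j j' h => Subtype.ext ?_, ?_⟩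
  · rw [← j.2.2.choose_spec, ← j'.2.2.choose_spec]
    simpa using h
  · refine lt_of_le_of_lt (measureReal_mono (fun ω hω => ?_) (measure_ne_top _ _)) hm
    by_contra hc
    have hmem : f ω ∈ K := ⟨not_le.1 hc, ω.1, rfl⟩
    refine hω ⟨f ω, hmem⟩ ?_
    have h2 := hmem.2.choose_spec
    exact Set.Finite.toFinset_inj.1 h2.symm

theorem fbpTruncProb_le_sum {r : ℕ} {𝒯 : Set (FeaturedRootedGraph F)} (h𝒯 : MeasurableSet 𝒯)
    {J : Type*} [Fintype J] (N : J → List ℕ → ℕ) :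
    fbpTruncProb c D r 𝒯 ≤ ∑ j, fbpShapeProb c D (N j) r (shapeFeatures (N j) r 𝒯) +
      (fbpMeasure c D).real {ω | ∀ j, bornUpTo ω.1 r ≠ bornUpTo (N j) r} := by
  have hsub : {ω : (List ℕ → ℕ) × (List ℕ → F) | truncatedTree r ω.1 ω.2 ∈ 𝒯} ⊆
      (⋃ j, {ω | bornUpTo ω.1 r = bornUpTo (N j) r ∧ truncatedTree r ω.1 ω.2 ∈ 𝒯}) ∪
        {ω | ∀ j, bornUpTo ω.1 r ≠ bornUpTo (N j) r} := by
    intro ω hω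
    by_cases h : ∀ j, bornUpTo ω.1 r ≠ bornUpTo (N j) r
    · exact Or.inr h
    · push Not at h
      obtain ⟨j, hj⟩ := h
      exact Or.inl (Set.mem_iUnion.2 ⟨j, hj, hω⟩)
  refine (measureReal_mono hsub (measure_ne_top _ _)).trans
    ((measureReal_union_le _ _).trans (add_le_add_left ?_ _))
  exact (measureReal_iUnion_fintype_le _).trans
    (Finset.sum_le_sum fun j _ => fbpMeasure_real_bornUpTo_eq_le c D (N j) r h𝒯)

/-! ### The lower bound and its application to the complement. -/

theorem tendsto_measureReal_ballProportion_lt {r : ℕ} {𝒯 : Set (FeaturedRootedGraph F)}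
    (h𝒯 : MeasurableSet 𝒯) {ε : ℝ} (hε : 0 < ε) :
    Tendsto (fun n : ℕ =>
      (featuredGnp D n (Set.projIcc (0 : ℝ) 1 zero_le_one ((c : ℝ) / n))).real
        {ω | ballProportion ω.1 ω.2 r 𝒯 < fbpTruncProb c D r 𝒯 - ε}) atTop (𝓝 0) := by
  obtain ⟨J, _, N, hN, hJ⟩ := exists_finite_shapes c D r (half_pos hε)
  -- Half of `ε` pays for the omitted shapes, the other half is shared among the retained ones; the
  -- `+ 1` covers an empty `J`.
  let δ : ℝ := ε / 2 / (Fintype.card J + 1)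
  have hδ : 0 < δ := by positivity
  have hlim := tendsto_finsetSum (Finset.univ : Finset J) fun j _ =>
    tendsto_measureReal_copyCount_lt D c (measurableSet_shapeFeatures (N j) r h𝒯) hδ
  rw [Finset.sum_const_zero] at hlim
  refine squeeze_zero (fun _ => measureReal_nonneg) (fun n => ?_) hlim
  refine (measureReal_mono ?_ (measure_ne_top _ _)).trans (measureReal_iUnion_fintype_le _)
  intro ω hω
  rw [Set.mem_iUnion]
  by_contra! hc
  have hc' : ∀ j, fbpShapeProb c D (N j) r (shapeFeatures (N j) r 𝒯) - δ ≤
      (Set.ncard {φ : {φ : bornUpTo (N j) r → Fin n // IsSiblingIncreasing (N j) r φ} |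
          ω ∈ copyEvent (N j) r (shapeFeatures (N j) r 𝒯) φ.1} : ℝ) * (1 / n : ℝ) :=
    fun j => not_lt.1 (hc j)
  have hsum := Finset.sum_le_sum fun j (_ : j ∈ Finset.univ) => hc' j
  rw [Finset.sum_sub_distrib, ← Finset.sum_mul, Finset.sum_const, nsmul_eq_mul,
    Finset.card_univ] at hsum
  have hcount : (∑ j, (Set.ncard {φ : {φ : bornUpTo (N j) r → Fin n //
      IsSiblingIncreasing (N j) r φ} |
        ω ∈ copyEvent (N j) r (shapeFeatures (N j) r 𝒯) φ.1} : ℝ)) * (1 / n : ℝ) ≤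
      ballProportion ω.1 ω.2 r 𝒯 := by
    rw [ballProportion, mul_one_div]
    exact div_le_div_of_nonneg_right (by exact_mod_cast sum_ncard_copyEvent_le hN 𝒯 ω)
      (Nat.cast_nonneg n)
  have hδ2 : (Fintype.card J : ℝ) * δ ≤ ε / 2 := by
    have : ((Fintype.card J : ℝ) + 1) * δ = ε / 2 := by
      simp only [δ]
      field_simp
    linarith
  have hF := fbpTruncProb_le_sum c D (r := r) h𝒯 N
  have hω' : ballProportion ω.1 ω.2 r 𝒯 < fbpTruncProb c D r 𝒯 - ε := hω
  linarith

theorem one_le_fbpTruncProb_add_compl (r : ℕ) (𝒯 : Set (FeaturedRootedGraph F)) :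
    1 ≤ fbpTruncProb c D r 𝒯 + fbpTruncProb c D r 𝒯ᶜ := by
  rw [← probReal_univ (μ := fbpMeasure c D)]
  refine le_trans (measureReal_mono (fun ω _ => ?_) (measure_ne_top _ _)) (measureReal_union_le _ _)
  exact em (truncatedTree r ω.1 ω.2 ∈ 𝒯)

end

theorem ballProportion_compl {F : Type*} {n : ℕ} (hn : 0 < n) (G : SimpleGraph (Fin n))
    (χ : Fin n → F) (r : ℕ) (𝒯 : Set (FeaturedRootedGraph F)) :
    ballProportion G χ r 𝒯ᶜ = 1 - ballProportion G χ r 𝒯 := by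
  have h := Set.ncard_add_ncard_compl {v : Fin n | featuredBall G χ r v ∈ 𝒯}
  rw [Nat.card_eq_fintype_card, Fintype.card_fin] at h
  have h' : (Set.ncard {v : Fin n | featuredBall G χ r v ∈ 𝒯} : ℝ) +
      Set.ncard {v : Fin n | featuredBall G χ r v ∈ 𝒯ᶜ} = n := by exact_mod_cast h
  have hn' : (n : ℝ) ≠ 0 := by positivity
  rw [ballProportion, ballProportion, eq_sub_iff_add_eq, ← add_div, add_comm, h', div_self hn']

theorem mainTheorem8 {F : Type*} [MeasurableSpace F] (D : Measure F) [IsProbabilityMeasure D]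
    (c : ℝ≥0) (hc : 0 < c) (r : ℕ) (𝒯 : Set (FeaturedRootedGraph F)) (h𝒯 : MeasurableSet 𝒯)
    (htree : ∀ T ∈ 𝒯, T.IsTreeOfHeightLE r) (ε : ℝ) (hε : 0 < ε) :
    Tendsto
      (fun n : ℕ =>
        (featuredGnp D n (Set.projIcc (0 : ℝ) 1 zero_le_one ((c : ℝ) / n))).real
          {ω | ε < |ballProportion ω.1 ω.2 r 𝒯 - fbpTruncProb c D r 𝒯|})
      atTop (𝓝 0) := by
  -- The lower bound is valid for every measurable set, hence also for `𝒯ᶜ`, which contains the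
  -- classes of graphs with cycles.
  have h := (tendsto_measureReal_ballProportion_lt c D (r := r) h𝒯 hε).add
    (tendsto_measureReal_ballProportion_lt c D (r := r) h𝒯.compl hε)
  rw [add_zero] at h
  refine squeeze_zero' (Eventually.of_forall fun _ => measureReal_nonneg) ?_ h
  filter_upwards [eventually_gt_atTop 0] with n hn
  refine (measureReal_mono ?_ (measure_ne_top _ _)).trans (measureReal_union_le _ _)
  intro ω hω
  have hsum := one_le_fbpTruncProb_add_compl c D r 𝒯
  rcases lt_abs.1 (Set.mem_ofPred_eq.mp hω) with h1 | h1
  · refine Or.inr ?_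
    change ballProportion ω.1 ω.2 r 𝒯ᶜ < _
    rw [ballProportion_compl hn]
    linarith
  · refine Or.inl ?_
    change ballProportion ω.1 ω.2 r 𝒯 < _
    linarith
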